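/- **Setting.** Consider a Markov decision process with state space $\mathcal S$, action space $\mathcal A$ (a separable metric space), transition law $T(\cdot\mid s,a)$, bounded reward $r(s,a)$ and discount factor $\gamma\in(0,1)$, and an initial state distribution $\rho_0$. For a policy $\pi$ let $Q^\pi(s,a)=\mathbb E\big[\sum_{k\ge 0}\gamma^k r(s_k,a_k)\mid s_0=s,a_0=a\big]$, let $(\mathcal B^\pi Q)(s,a)=r(s,a)+\gamma\,\mathbb E_{s'\sim T(\cdot|s,a),\,a'\sim\pi(\cdot|s')}Q(s',a')$, and let $\rho_j(\cdot\mid\rho_0,\pi,T)$ be the distribution of $s_j$ when $s_0\sim\rho_0$ and actions follow $\pi$. Let $\pi^1,\dots,\pi^N$ ($N\ge1$) be policies and, for each episode $e$, let $(s_j^e,a_j^e)_{j=0}^{L-1}$ be a length-$L$ trajectory sampled under $(\rho_0,\pi^e,T)$, the $N$ trajectories being independent; the policies and the learned function $\hat Q:\mathcal S\times\mathcal A\to\mathbb R$ are fixed, i.e. they do not depend on the sampled trajectories. For a step $0\le i\le L$ write $\rho_j^e=\rho_j(\cdot\mid\rho_0,\pi^e,T)$, $o_i^e=(1-\gamma)\sum_{j\ge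 i}\gamma^{j-i}\rho_j^e$, and $$\overline\rho_i=\frac1N\sum_{e=1}^N\rho_i^e,\qquad \pi_i^D(a\mid s)=\frac{\sum_e\pi^e(a\mid s)\,o_i^e(s)}{\sum_e o_i^e(s)},\qquad \tilde E_i^L f=\frac1N\sum_{e=1}^N\sum_{j=i}^{L-1}(1-\gamma)\gamma^{j-i}f(s_j^e,a_j^e),$$ $$W_1^{i,L}=\tilde E_i^L\,W_1\big(\pi^N(\cdot|s),\pi_i^D(\cdot|s)\big),\qquad \epsilon_{\hat Q}^{i,L}=\tilde E_i^L\big|\hat Q-\mathcal B^{\pi^N}\hat Q\big|,$$ where $W_1$ is the 1-Wasserstein distance on $\mathcal A$. **Assumptions.** (1) For each $s$, $\hat Q(s,\cdot)$ and $Q^{\pi^N}(s,\cdot)$ are $L_{\mathcal A}$-Lipschitz. (2) $\hat Q$ and $Q^{\pi^N}$ take values in $[0,r^{\max}/(1-\gamma)]$. (3) $\mathcal A$ is bounded, with diameter $\mathrm{diam}_{\mathcal A}<\infty$. **Conclusions.** For every $\delta\in(0,1)$, with probability greater than $1-\delta$, $$\mathbb E_{s\sim\overline\rho_i,\,a\sim\pi_i^D(\cdot|s)}\big|\hat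 Q(s,a)-Q^{\pi^N}(s,a)\big|\le \frac{r^{\max}}{1-\gamma}\sqrt{\frac1{2N}\log\frac2\delta}+\Big(\frac{r^{\max}}{(1-\gamma)^2}+\frac{2L_{\mathcal A}\mathrm{diam}_{\mathcal A}}{1-\gamma}\Big)\Big(\sqrt{\frac2N\log\frac2\delta}+\gamma^{L-i}\Big)+\frac1{1-\gamma}\Big(\epsilon_{\hat Q}^{i,L}+2L_{\mathcal A}W_1^{i,L}\Big).$$ Moreover, if $0<\epsilon<1$, $i\le L-\frac{\log\epsilon}{\log\gamma}$, $L_{\mathcal A}=c/(1-\gamma)$ and $\epsilon_{\hat Q}^{i,L}=\xi_{\hat Q}^{i,L}/(1-\gamma)$, then, with probability greater than $1-\delta$, $$\mathbb E_{s\sim\overline\rho_i,\,a\sim\pi_i^D(\cdot|s)}\big|\hat Q(s,a)-Q^{\pi^N}(s,a)\big|\le \tilde O\Big(\frac1{(1-\gamma)^2}\Big((r^{\max}+c\cdot\mathrm{diam}_{\mathcal A})\big(1/\sqrt N+\epsilon\big)+\xi_{\hat Q}^{i,L}+c\cdot W_1^{i,L}\Big)\Big),$$ where $\tilde O(\cdot)$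 hides an absolute constant and the logarithmic factor $\sqrt{\log(2/\delta)}$. -/

import Mathlib

open MeasureTheory ProbabilityTheory
open scoped ENNReal NNReal

namespace OffPolicy

noncomputable section

/-- The 1-Wasserstein distance: the infimum of the transport cost `∫ d(x, y) dκ(x, y)` over all
couplings `κ` of `μ` and `ν`. -/
def wasserstein {A : Type*} [MetricSpace A] [MeasurableSpace A] (μ ν : Measure A) : ℝ≥0∞ :=
  ⨅ (κ : Measure (A × A)) (_ : κ.fst = μ ∧ κ.snd = ν), ∫⁻ p, edist p.1 p.2 ∂κ

variable {S A : Type*} [MeasurableSpace S] [MeasurableSpace A]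

/-- One transition of the state-action chain: from `(s, a)` draw `s' ∼ T(· | s, a)` and then
`a' ∼ π(· | s')`. -/
def transition (T : Kernel (S × A) S) (π : Kernel S A) : Kernel (S × A) (S × A) :=
  T ⊗ₖ Kernel.prodMkLeft (S × A) π

instance (T : Kernel (S × A) S) (π : Kernel S A) [IsMarkovKernel T] [IsMarkovKernel π] :
    IsMarkovKernel (transition T π) := by
  unfold transition; infer_instance

/-- The transition at time `n`, as a function of the history `(s₀, a₀), …, (sₙ, aₙ)`: it depends
on the last state-action pair only. -/
def historyKernel (T : Kernel (S × A) S) (π : Kernel S A) (n : ℕ) :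
    Kernel (Finset.Iic n → S × A) (S × A) :=
  (transition T π).comap (fun h => h ⟨n, Finset.mem_Iic.2 le_rfl⟩) (measurable_pi_apply _)

instance (T : Kernel (S × A) S) (π : Kernel S A) [IsMarkovKernel T] [IsMarkovKernel π] (n : ℕ) :
    IsMarkovKernel (historyKernel T π n) := by
  unfold historyKernel; infer_instance

/-- The law of the infinite trajectory `(sⱼ, aⱼ)_{j ≥ 0}` when `(s₀, a₀) ∼ μ`,
`sⱼ₊₁ ∼ T(· | sⱼ, aⱼ)` and `aⱼ₊₁ ∼ π(· | sⱼ₊₁)`. -/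
def trajectoryFrom (T : Kernel (S × A) S) [IsMarkovKernel T] (π : Kernel S A) [IsMarkovKernel π]
    (μ : Measure (S × A)) : Measure (ℕ → S × A) :=
  Kernel.trajMeasure (X := fun _ => S × A) μ (historyKernel T π)

/-- The law of the infinite trajectory with `s₀ ∼ ρ₀`, `aⱼ ∼ π(· | sⱼ)` and
`sⱼ₊₁ ∼ T(· | sⱼ, aⱼ)`. -/
def trajectory (T : Kernel (S × A) S) [IsMarkovKernel T] (ρ₀ : Measure S)
    (π : Kernel S A) [IsMarkovKernel π] : Measure (ℕ → S × A) :=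
  trajectoryFrom T π (ρ₀ ⊗ₘ π)

/-- The law of a length-`L` trajectory `(s₀, a₀), …, (s_{L-1}, a_{L-1})`. -/
def episodeLaw (T : Kernel (S × A) S) [IsMarkovKernel T] (ρ₀ : Measure S)
    (π : Kernel S A) [IsMarkovKernel π] (L : ℕ) : Measure (Fin L → S × A) :=
  (trajectory T ρ₀ π).map (fun x j => x j)

/-- The Q function `Q^π(s, a) = 𝔼[∑ᵢ γⁱ r(sᵢ, aᵢ) | s₀ = s, a₀ = a]`. -/
def qFunction (T : Kernel (S × A) S) [IsMarkovKernel T] (r : S → A → ℝ) (γ : ℝ)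
    (π : Kernel S A) [IsMarkovKernel π] (s : S) (a : A) : ℝ :=
  ∫ x, ∑' i : ℕ, γ ^ i * r (x i).1 (x i).2 ∂(trajectoryFrom T π (Measure.dirac (s, a)))

/-- The Bellman operator
`(ℬ^π Q)(s, a) = r(s, a) + γ 𝔼_{s' ∼ T(· | s, a), a' ∼ π(· | s')} Q(s', a')`. -/
def bellman (T : Kernel (S × A) S) (r : S → A → ℝ) (γ : ℝ) (π : Kernel S A)
    (Q : S → A → ℝ) (s : S) (a : A) : ℝ :=
  r s a + γ * ∫ s', ∫ a', Q s' a' ∂(π s') ∂(T (s, a))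

/-- The state distribution `ρ_j(· | ρ₀, π, T)` at trajectory step `j`. -/
def stateDist (T : Kernel (S × A) S) [IsMarkovKernel T] (ρ₀ : Measure S)
    (π : Kernel S A) [IsMarkovKernel π] (j : ℕ) : Measure S :=
  (trajectory T ρ₀ π).map (fun x => (x j).1)

/-- The normalized state occupancy measure started at trajectory step `i`,
`(1 - γ) ∑_{j ≥ i} γ^{j - i} ρ_j(· | ρ₀, π, T)` (with the summation index `k = j - i`). -/
def occupancy (T : Kernel (S × A) S) [IsMarkovKernel T] (ρ₀ : Measure S) (γ : ℝ)
    (π : Kernel S A) [IsMarkovKernel π] (i : ℕ) : Measure S :=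
  Measure.sum fun k : ℕ => ENNReal.ofReal ((1 - γ) * γ ^ k) • stateDist T ρ₀ π (i + k)

/-- The state distribution at step `i` averaged over the `N` episodes. -/
def avgStateDist {N : ℕ} (T : Kernel (S × A) S) [IsMarkovKernel T] (ρ₀ : Measure S)
    (π : Fin N → Kernel S A) [∀ e, IsMarkovKernel (π e)] (i : ℕ) : Measure S :=
  (N : ℝ≥0∞)⁻¹ • ∑ e, stateDist T ρ₀ (π e) i

/-- The behavior policy at step `i`,
`π_i^D(· | s) = (∑ₑ oₑ(s) πᵉ(· | s)) / (∑ₑ oₑ(s))` with `oₑ` the density of the occupancy measure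
of episode `e` started at step `i`. The ratio `oₑ / ∑ₑ' oₑ'` of densities is the Radon-Nikodym
derivative of the `e`-th occupancy measure with respect to the sum of all of them, which makes
sense without a reference measure on `S`; where one exists (e.g. Lebesgue measure), the two
expressions agree almost everywhere with respect to the sum of the occupancy measures. -/
def behaviorPolicy {N : ℕ} (T : Kernel (S × A) S) [IsMarkovKernel T] (ρ₀ : Measure S) (γ : ℝ)
    (π : Fin N → Kernel S A) [∀ e, IsMarkovKernel (π e)] (i : ℕ) (s : S) : Measure A :=
  ∑ e, ((occupancy T ρ₀ γ (π e) i).rnDeriv (∑ e', occupancy T ρ₀ γ (π e') i)) s • π e s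

/-- The averaging-discounted operator over the replay buffer `x` of `N` trajectories of length `L`,
`Ẽ_i^L f = N⁻¹ ∑ₑ ∑_{j=i}^{L-1} (1 - γ) γ^{j - i} f(sⱼᵉ, aⱼᵉ)`. -/
def bufferAvg {N L : ℕ} (γ : ℝ) (i : ℕ) (x : Fin N → Fin L → S × A) (f : S → A → ℝ) : ℝ :=
  (N : ℝ)⁻¹ * ∑ e : Fin N, ∑ j ∈ Finset.univ.filter (fun j : Fin L => i ≤ (j : ℕ)),
    (1 - γ) * γ ^ ((j : ℕ) - i) * f (x e j).1 (x e j).2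

/-- The Bellman error `ε_Q^{i,L} = Ẽ_i^L |Q - ℬ^π Q|` of `Q` on the replay buffer. -/
def bellmanError {N L : ℕ} (T : Kernel (S × A) S) (r : S → A → ℝ) (γ : ℝ) (π : Kernel S A)
    (Q : S → A → ℝ) (i : ℕ) (x : Fin N → Fin L → S × A) : ℝ :=
  bufferAvg γ i x fun s a => |Q s a - bellman T r γ π Q s a|

/-- The policy mismatch error `Ẽ_i^L W₁(π(· | ·), π'(· | ·))` on the replay buffer. -/
def mismatchError {N L : ℕ} [MetricSpace A] (γ : ℝ) (π π' : S → Measure A) (i : ℕ)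
    (x : Fin N → Fin L → S × A) : ℝ :=
  bufferAvg γ i x fun s _ => (wasserstein (π s) (π' s)).toReal

/-- The error `𝔼_{s ∼ ρ, a ∼ π(· | s)} |Q(s, a) - Q'(s, a)|`. -/
def evaluationError (ρ : Measure S) (π : S → Measure A) (Q Q' : S → A → ℝ) : ℝ :=
  ∫ s, ∫ a, |Q s a - Q' s a| ∂(π s) ∂ρ

end

end OffPolicy

open OffPolicy

/-!
Write `Q` for the Q function of the target policy `πN`, `g = Qhat - Q`, `b = Qhat - ℬ Qhat`,
`V = rmax / (1 - γ)`. Since `Q = ℬ Q` (`qFunction_eq_integral_transition`), `g` solves the Bellman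
equation `g = b + γ 𝔼 g` (`sub_qFunction_eq`), so `|g(s, a)|` is at most `|b(s, a)|` plus `γ` times
the expectation, over the next state, of `m(s') = 𝔼_{a' ∼ πN(· | s')} |g(s', a')|`. Replacing `πN` by
the behavior policy turns `m` into `h(s') = 𝔼_{a' ∼ π^D(· | s')} |g(s', a')|` at the cost of a gap
`D(s')`, at most `2 LA W₁(πN(· | s'), π^D(· | s'))` by the Lipschitz property
(`lintegral_enorm_sub_le_wasserstein`).

The behavior policy mixes the episodes' policies with the weights of their occupancy measures.
Hence the discounted sums over `j ≥ i` of `𝔼 h(s_j)` and of `𝔼 |g(s_j, a_j)|`, averaged over the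
episodes, are equal (`tsum_lintegral_behaviorPolicy`), although the summands differ. In the second
sum use the recursion for `j < L` and `|g| ≤ V` for `j ≥ L`. Everything on the right that involves
`h` is then a part of the first sum and cancels; only the term `j = i` has to be kept
(`discounted_head_le`), which gives
`(1 - γ) 𝔼 h(s_i) ≤ ∑_{i ≤ j < L} (1 - γ) γ^(j-i) 𝔼 (|b| + D)(s_j, a_j) + γ^(L-i) (V + 2 LA diam)`
(`integral_behaviorPolicy_le`).

The sum on the right is the expectation of a buffer average of independent variables in
`[0, 2 (V + 2 LA diam)]`, so one-sided Hoeffding (`measure_bufferAvg_add_lt`) bounds it by its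
empirical value plus the concentration term, with failure probability `δ / 2 < δ`. On the buffer,
`D` is then bounded by the Wasserstein distance. Concentration is applied to `D` and not to the
Wasserstein distance because `D` is measurable (`policyGap`). The second conclusion follows by
elementary estimates (`bound_le_rate`), with constant `4`.
-/

namespace OffPolicy

/-! ### Step laws of a trajectory -/

section Trajectory

variable {S A : Type*} [MeasurableSpace S] [MeasurableSpace A]
  (T : Kernel (S × A) S) [IsMarkovKernel T] (π : Kernel S A) [IsMarkovKernel π]

instance (μ : Measure (S × A)) [IsProbabilityMeasure μ] :
    IsProbabilityMeasure (trajectoryFrom T π μ) := by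
  unfold trajectoryFrom; infer_instance

instance (ρ₀ : Measure S) [IsProbabilityMeasure ρ₀] :
    IsProbabilityMeasure (trajectory T ρ₀ π) := by
  unfold trajectory; infer_instance

theorem map_eval_zero_trajectoryFrom (μ : Measure (S × A)) [IsProbabilityMeasure μ] :
    (trajectoryFrom T π μ).map (fun x => x 0) = μ := by
  have h0 : (fun x : ℕ → S × A => x 0) =
      (MeasurableEquiv.piUnique (fun _ : Finset.Iic 0 => S × A)) ∘
        Preorder.frestrictLe (π := fun _ => S × A) 0 := by
    ext x <;> rfl
  rw [h0, ← Measure.map_map (by fun_prop) (by fun_prop)]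
  unfold trajectoryFrom Kernel.trajMeasure
  rw [Measure.map_comp _ _ (by fun_prop), Kernel.traj_map_frestrictLe,
    Kernel.partialTraj_self, Measure.id_comp, Measure.map_map (by fun_prop) (by fun_prop)]
  convert Measure.map_id
  ext x <;> simp

theorem map_eval_succ_trajectoryFrom (μ : Measure (S × A)) [IsProbabilityMeasure μ] (n : ℕ) :
    (trajectoryFrom T π μ).map (fun x => x (n + 1)) =
      transition T π ∘ₘ (trajectoryFrom T π μ).map (fun x => x n) := by
  have h := Kernel.map_frestrictLe_trajMeasure_compProd_eq_map_trajMeasure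
    (X := fun _ => S × A) (μ₀ := μ) (κ := historyKernel T π) (a := n)
  have h2 := congrArg Measure.snd h
  rw [Measure.snd_compProd, Measure.snd, Measure.map_map (by fun_prop) (by fun_prop)] at h2
  change _ = (trajectoryFrom T π μ).map (fun x => x (n + 1)) at h2
  rw [← h2]
  have h1 : (trajectoryFrom T π μ).map (fun x => x n) =
      ((trajectoryFrom T π μ).map (Preorder.frestrictLe (π := fun _ => S × A) n)).map
        (fun h => h ⟨n, Finset.mem_Iic.2 le_rfl⟩) := by
    rw [Measure.map_map (by fun_prop) (by fun_prop)]; rfl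
  rw [h1]
  change historyKernel T π n ∘ₘ (trajectoryFrom T π μ).map (Preorder.frestrictLe n) = _
  ext s hs
  rw [Measure.bind_apply hs (Kernel.aemeasurable _), Measure.bind_apply hs (Kernel.aemeasurable _),
    lintegral_map (Kernel.measurable_coe _ hs) (by fun_prop),
    Measure.map_map (by fun_prop) (by fun_prop),
    lintegral_map (Kernel.measurable_coe _ hs) (by fun_prop)]
  rfl

/-- The law of the pair `(sⱼ, aⱼ)` along a trajectory started from `ρ₀`. -/
noncomputable def pairDist (ρ₀ : Measure S) (j : ℕ) : Measure (S × A) :=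
  (trajectory T ρ₀ π).map (fun x => x j)

variable (ρ₀ : Measure S) [IsProbabilityMeasure ρ₀]

instance (j : ℕ) : IsProbabilityMeasure (pairDist T π ρ₀ j) :=
  Measure.isProbabilityMeasure_map (measurable_pi_apply j).aemeasurable

instance (j : ℕ) : IsProbabilityMeasure (stateDist T ρ₀ π j) :=
  Measure.isProbabilityMeasure_map (measurable_pi_apply j).fst.aemeasurable

omit [IsProbabilityMeasure ρ₀] in
theorem fst_pairDist (j : ℕ) : (pairDist T π ρ₀ j).fst = stateDist T ρ₀ π j := by
  rw [Measure.fst, pairDist, Measure.map_map (by fun_prop) (by fun_prop)]; rfl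

theorem pairDist_succ_eq_comp (j : ℕ) :
    pairDist T π ρ₀ (j + 1) = transition T π ∘ₘ pairDist T π ρ₀ j :=
  map_eval_succ_trajectoryFrom ..

theorem stateDist_succ (j : ℕ) :
    stateDist T ρ₀ π (j + 1) = T ∘ₘ pairDist T π ρ₀ j := by
  rw [← fst_pairDist, pairDist_succ_eq_comp, Measure.fst, Measure.map_comp _ _ measurable_fst,
    ← Kernel.fst_eq, transition, Kernel.fst_compProd]

/-- At every step the action is drawn from the policy at the current state. -/
theorem pairDist_eq_compProd (j : ℕ) :
    pairDist T π ρ₀ j = stateDist T ρ₀ π j ⊗ₘ π := by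
  cases j with
  | zero =>
    have h : pairDist T π ρ₀ 0 = ρ₀ ⊗ₘ π := map_eval_zero_trajectoryFrom ..
    rw [← fst_pairDist, h, Measure.fst_compProd]
  | succ j =>
    rw [pairDist_succ_eq_comp, stateDist_succ]
    refine Measure.ext_of_lintegral _ fun f hf => ?_
    rw [Measure.lintegral_bind (Kernel.aemeasurable _) hf.aemeasurable,
      Measure.lintegral_compProd hf,
      Measure.lintegral_bind (Kernel.aemeasurable _)
        hf.lintegral_kernel_prod_right'.aemeasurable]
    refine lintegral_congr fun z => ?_
    rw [transition, Kernel.lintegral_compProd _ _ _ hf]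
    rfl

end Trajectory

/-! ### The Q function as a discounted series -/

section QFunction

variable {S A : Type*} [MeasurableSpace S] [MeasurableSpace A]

/-- The `n`-step kernel of a Markov chain with transition kernel `K`. -/
noncomputable def iterKernel {Z : Type*} [MeasurableSpace Z] (K : Kernel Z Z) : ℕ → Kernel Z Z
  | 0 => Kernel.id
  | n + 1 => iterKernel K n ∘ₖ K

instance {Z : Type*} [MeasurableSpace Z] (K : Kernel Z Z) [IsMarkovKernel K] (n : ℕ) :
    IsMarkovKernel (iterKernel K n) := by
  induction n with
  | zero => unfold iterKernel; infer_instance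
  | succ n ih => unfold iterKernel; infer_instance

theorem iterKernel_succ' {Z : Type*} [MeasurableSpace Z] (K : Kernel Z Z) (n : ℕ) :
    iterKernel K (n + 1) = K ∘ₖ iterKernel K n := by
  induction n with
  | zero => simp [iterKernel]
  | succ n ih =>
    conv_lhs => rw [iterKernel, ih, Kernel.comp_assoc]
    rfl

variable (T : Kernel (S × A) S) [IsMarkovKernel T] (π : Kernel S A) [IsMarkovKernel π]

theorem map_eval_trajectoryFrom_dirac (z : S × A) (n : ℕ) :
    (trajectoryFrom T π (Measure.dirac z)).map (fun x => x n) =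
      iterKernel (transition T π) n z := by
  induction n with
  | zero => rw [map_eval_zero_trajectoryFrom]; simp [iterKernel, Kernel.id_apply]
  | succ n ih => rw [map_eval_succ_trajectoryFrom, ih, iterKernel_succ', Kernel.comp_apply]

variable {r : S → A → ℝ} {γ B : ℝ}

theorem qFunction_eq_tsum (hr : Measurable (Function.uncurry r)) (hB : ∀ s a, |r s a| ≤ B)
    (hγ0 : 0 < γ) (hγ1 : γ < 1) (z : S × A) :
    qFunction T r γ π z.1 z.2 =
      ∑' n : ℕ, γ ^ n * ∫ y, Function.uncurry r y ∂(iterKernel (transition T π) n z) := by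
  unfold qFunction
  have hi : ∀ n : ℕ, Integrable (fun x : ℕ → S × A => γ ^ n * r (x n).1 (x n).2)
      (trajectoryFrom T π (Measure.dirac z)) := fun n =>
    Integrable.of_bound (C := γ ^ n * B)
      ((hr.comp (measurable_pi_apply n)).const_mul _).aestronglyMeasurable
      (ae_of_all _ fun x => by
        rw [norm_mul, Real.norm_of_nonneg (pow_nonneg hγ0.le n)]
        exact mul_le_mul_of_nonneg_left (hB _ _) (pow_nonneg hγ0.le n))
  rw [← integral_tsum_of_summable_integral_norm hi]
  · refine tsum_congr fun n => ?_
    rw [integral_const_mul, ← map_eval_trajectoryFrom_dirac,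
      integral_map (measurable_pi_apply n).aemeasurable hr.aestronglyMeasurable]
    rfl
  · refine Summable.of_nonneg_of_le (fun n => integral_nonneg fun _ => norm_nonneg _)
      (fun n => ?_) ((summable_geometric_of_lt_one hγ0.le hγ1).mul_right B)
    calc _ ≤ ∫ _, γ ^ n * B ∂(trajectoryFrom T π (Measure.dirac z)) := by
          refine integral_mono (hi n).norm (integrable_const _) fun x => ?_
          dsimp only
          rw [norm_mul, Real.norm_of_nonneg (pow_nonneg hγ0.le n)]
          exact mul_le_mul_of_nonneg_left (hB _ _) (pow_nonneg hγ0.le n)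
      _ = _ := by simp

theorem abs_integral_le_of_abs_le {Z : Type*} [MeasurableSpace Z] {f : Z → ℝ} {B : ℝ}
    (hB : ∀ z, |f z| ≤ B) (μ : Measure Z) [IsProbabilityMeasure μ] : |∫ z, f z ∂μ| ≤ B := by
  simpa using norm_integral_le_of_norm_le_const (μ := μ) (f := f) (ae_of_all _ hB)

theorem measurable_qFunction (hr : Measurable (Function.uncurry r)) (hB : ∀ s a, |r s a| ≤ B)
    (hγ0 : 0 < γ) (hγ1 : γ < 1) : Measurable (Function.uncurry (qFunction T r γ π)) := by
  have h : Function.uncurry (qFunction T r γ π) = fun z =>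
      ∑' n : ℕ, γ ^ n * ∫ y, Function.uncurry r y ∂(iterKernel (transition T π) n z) :=
    funext fun z => qFunction_eq_tsum T π hr hB hγ0 hγ1 z
  rw [h]
  exact Measurable.tsum fun n =>
    (hr.stronglyMeasurable.integral_kernel (κ := iterKernel (transition T π) n)).measurable.const_mul _

/-- The Q function is a fixed point of the Bellman operator. -/
theorem qFunction_eq_integral_transition (hr : Measurable (Function.uncurry r))
    (hB : ∀ s a, |r s a| ≤ B) (hγ0 : 0 < γ) (hγ1 : γ < 1) (z : S × A) :
    qFunction T r γ π z.1 z.2 =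
      r z.1 z.2 + γ * ∫ y, qFunction T r γ π y.1 y.2 ∂(transition T π z) := by
  have hB' : ∀ y, |Function.uncurry r y| ≤ B := fun y => hB _ _
  set K := transition T π
  set c : ℕ → S × A → ℝ := fun n z => ∫ y, Function.uncurry r y ∂(iterKernel K n z) with hc
  have hcm : ∀ n, Measurable (c n) := fun n =>
    (hr.stronglyMeasurable.integral_kernel (κ := iterKernel K n)).measurable
  have hcB : ∀ n y, |c n y| ≤ B := fun n y => abs_integral_le_of_abs_le hB' _
  have hnorm : ∀ n y, ‖γ ^ n * c n y‖ ≤ γ ^ n * B := fun n y => by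
    rw [norm_mul, Real.norm_of_nonneg (pow_nonneg hγ0.le n)]
    exact mul_le_mul_of_nonneg_left (hcB _ _) (pow_nonneg hγ0.le n)
  have hgeo : Summable fun n : ℕ => γ ^ n * B := (summable_geometric_of_lt_one hγ0.le hγ1).mul_right B
  have hsucc : ∀ n, c (n + 1) z = ∫ y, c n y ∂(K z) := fun n => by
    rw [hc]
    simp only [iterKernel]
    exact Kernel.integral_comp (Integrable.of_bound hr.aestronglyMeasurable (C := B)
      (ae_of_all _ hB'))
  have hi : ∀ n, Integrable (fun y => γ ^ n * c n y) (K z) := fun n =>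
    Integrable.of_bound ((hcm n).const_mul _).aestronglyMeasurable (γ ^ n * B)
      (ae_of_all _ (hnorm n))
  have hQ : ∀ y : S × A, qFunction T r γ π y.1 y.2 = ∑' n, γ ^ n * c n y :=
    fun y => qFunction_eq_tsum T π hr hB hγ0 hγ1 y
  have hint : ∫ y, qFunction T r γ π y.1 y.2 ∂(K z) = ∑' n, γ ^ n * c (n + 1) z := by
    simp_rw [hQ]
    rw [← integral_tsum_of_summable_integral_norm hi]
    · simp_rw [integral_const_mul, hsucc]
    · refine Summable.of_nonneg_of_le (fun n => integral_nonneg fun _ => norm_nonneg _)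
        (fun n => ?_) hgeo
      refine (integral_mono (hi n).norm (integrable_const (γ ^ n * B)) (hnorm n)).trans ?_
      simp
  rw [hint, hQ, (Summable.of_norm_bounded hgeo fun n => hnorm n z).tsum_eq_zero_add, ← tsum_mul_left]
  congr 1
  · simp only [hc, iterKernel, Kernel.id_apply, pow_zero, one_mul]
    rw [integral_dirac' _ _ hr.stronglyMeasurable, Function.uncurry]
  · refine tsum_congr fun n => by ring

theorem integral_transition {f : S × A → ℝ} (z : S × A) (hf : Integrable f (transition T π z)) :
    ∫ y, f y ∂(transition T π z) = ∫ s', ∫ a', f (s', a') ∂(π s') ∂(T z) := by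
  rw [transition] at hf ⊢
  rw [ProbabilityTheory.integral_compProd hf]
  rfl

end QFunction

/-! ### Mixtures weighted by Radon-Nikodym derivatives -/

section Mixture

variable {S A : Type*} [MeasurableSpace S] [MeasurableSpace A]

theorem absolutelyContinuous_sum {ι : Type*} [Fintype ι] (o : ι → Measure S) (e : ι) :
    o e ≪ ∑ e', o e' := by
  refine Measure.absolutelyContinuous_of_le (Measure.le_iff.2 fun s _ => ?_)
  rw [Measure.finsetSum_apply]
  exact Finset.single_le_sum (f := fun e => o e s) (fun _ _ => zero_le) (Finset.mem_univ e)

theorem sum_rnDeriv_ae_eq_one {ι : Type*} [Fintype ι] (o : ι → Measure S)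
    [∀ e, IsFiniteMeasure (o e)] :
    ∀ᵐ s ∂(∑ e, o e), ∑ e, (o e).rnDeriv (∑ e', o e') s = 1 := by
  set ν := ∑ e, o e with hν
  have h : ν.withDensity (fun s => ∑ e, (o e).rnDeriv ν s) = ν.withDensity 1 := by
    rw [withDensity_one]
    refine Measure.ext fun t ht => ?_
    rw [withDensity_apply _ ht, lintegral_finsetSum _ fun e _ => Measure.measurable_rnDeriv _ _]
    conv_rhs => rw [hν, Measure.finsetSum_apply]
    exact Finset.sum_congr rfl fun e _ =>
      Measure.setLIntegral_rnDeriv (absolutelyContinuous_sum o e) t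
  exact (withDensity_eq_iff (Finset.measurable_fun_sum _ fun e _ =>
    Measure.measurable_rnDeriv _ _).aemeasurable measurable_one.aemeasurable
    (by rw [← setLIntegral_univ, ← withDensity_apply _ .univ, h, withDensity_one]
        exact measure_ne_top _ _)).1 h

theorem lintegral_mixture {ι : Type*} [Fintype ι] (w : ι → ℝ≥0∞) (μ : ι → Measure A)
    (f : A → ℝ≥0∞) : ∫⁻ a, f a ∂(∑ e, w e • μ e) = ∑ e, w e * ∫⁻ a, f a ∂(μ e) := by
  rw [lintegral_finsetSum_measure]
  simp [lintegral_smul_measure]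

/-- Disintegration of a finite sum of measures `o e ⊗ π e` along the sum of the `o e`. -/
theorem lintegral_lintegral_mixture {ι : Type*} [Fintype ι] (o : ι → Measure S)
    [∀ e, IsFiniteMeasure (o e)] (π : ι → Kernel S A) [∀ e, IsMarkovKernel (π e)]
    {f : S × A → ℝ≥0∞} (hf : Measurable f) :
    ∫⁻ s, ∫⁻ a, f (s, a) ∂(∑ e, (o e).rnDeriv (∑ e', o e') s • π e s) ∂(∑ e', o e') =
      ∑ e, ∫⁻ s, ∫⁻ a, f (s, a) ∂(π e s) ∂(o e) := by
  simp_rw [lintegral_mixture]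
  rw [lintegral_finsetSum (f := fun e s =>
      (o e).rnDeriv (∑ e', o e') s * ∫⁻ a, f (s, a) ∂(π e s)) _ fun e _ =>
    (Measure.measurable_rnDeriv _ _).mul hf.lintegral_kernel_prod_right']
  exact Finset.sum_congr rfl fun e _ =>
    lintegral_rnDeriv_mul (absolutelyContinuous_sum o e) hf.lintegral_kernel_prod_right'.aemeasurable

end Mixture

/-! ### Occupancy measures and the behavior policy -/

section Occupancy

variable {S A : Type*} [MeasurableSpace S] [MeasurableSpace A]
  (T : Kernel (S × A) S) [IsMarkovKernel T] (ρ₀ : Measure S) [IsProbabilityMeasure ρ₀]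
  {γ : ℝ}

omit [IsProbabilityMeasure ρ₀] in
theorem lintegral_occupancy (π : Kernel S A) [IsMarkovKernel π] (i : ℕ) (f : S → ℝ≥0∞) :
    ∫⁻ s, f s ∂(occupancy T ρ₀ γ π i) =
      ∑' k : ℕ, ENNReal.ofReal ((1 - γ) * γ ^ k) * ∫⁻ s, f s ∂(stateDist T ρ₀ π (i + k)) := by
  rw [occupancy, lintegral_sum_measure]
  simp [lintegral_smul_measure]

theorem tsum_ofReal_geometric (hγ0 : 0 < γ) (hγ1 : γ < 1) :
    ∑' k : ℕ, ENNReal.ofReal ((1 - γ) * γ ^ k) = 1 := by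
  rw [← ENNReal.ofReal_tsum_of_nonneg
    (fun k => mul_nonneg (by linarith) (pow_nonneg hγ0.le k))
    ((summable_geometric_of_lt_one hγ0.le hγ1).mul_left _), tsum_mul_left,
    tsum_geometric_of_lt_one hγ0.le hγ1, mul_inv_cancel₀ (by linarith), ENNReal.ofReal_one]

theorem isProbabilityMeasure_occupancy (hγ0 : 0 < γ) (hγ1 : γ < 1) (π : Kernel S A)
    [IsMarkovKernel π] (i : ℕ) : IsProbabilityMeasure (occupancy T ρ₀ γ π i) := by
  constructor
  have h := lintegral_occupancy T ρ₀ (γ := γ) π i 1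
  simpa [tsum_ofReal_geometric hγ0 hγ1] using h

omit [IsProbabilityMeasure ρ₀] in
theorem stateDist_absolutelyContinuous_occupancy (hγ0 : 0 < γ) (hγ1 : γ < 1) (π : Kernel S A)
    [IsMarkovKernel π] (i k : ℕ) : stateDist T ρ₀ π (i + k) ≪ occupancy T ρ₀ γ π i := by
  have h0 : ENNReal.ofReal ((1 - γ) * γ ^ k) ≠ 0 := by
    rw [Ne, ENNReal.ofReal_eq_zero, not_le]
    exact mul_pos (by linarith) (pow_pos hγ0 k)
  refine (Measure.absolutelyContinuous_smul h0).trans ?_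
  exact Measure.absolutelyContinuous_of_le (Measure.le_sum
    (fun k : ℕ => ENNReal.ofReal ((1 - γ) * γ ^ k) • stateDist T ρ₀ π (i + k)) k)

variable {N : ℕ} (π : Fin N → Kernel S A) [∀ e, IsMarkovKernel (π e)]

omit [IsProbabilityMeasure ρ₀] in
/-- Every property holding almost everywhere for the total occupancy measure holds almost surely
for the states visited from step `i` on. -/
theorem ae_stateDist_of_ae_sum_occupancy (hγ0 : 0 < γ) (hγ1 : γ < 1) {i : ℕ} {p : S → Prop}
    (hp : ∀ᵐ s ∂(∑ e, occupancy T ρ₀ γ (π e) i), p s) (e : Fin N) (k : ℕ) :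
    ∀ᵐ s ∂(stateDist T ρ₀ (π e) (i + k)), p s :=
  ((stateDist_absolutelyContinuous_occupancy T ρ₀ hγ0 hγ1 (π e) i k).trans
    (absolutelyContinuous_sum (fun e => occupancy T ρ₀ γ (π e) i) e)).ae_le hp

/-- The behavior policy is a probability measure only at almost every state; elsewhere the chosen
versions of the Radon-Nikodym derivatives need not sum to `1`. -/
theorem isProbabilityMeasure_behaviorPolicy (hγ0 : 0 < γ) (hγ1 : γ < 1) (i : ℕ) :
    ∀ᵐ s ∂(∑ e, occupancy T ρ₀ γ (π e) i),
      IsProbabilityMeasure (behaviorPolicy T ρ₀ γ π i s) := by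
  have := fun e => isProbabilityMeasure_occupancy T ρ₀ hγ0 hγ1 (π e) i
  filter_upwards [sum_rnDeriv_ae_eq_one fun e => occupancy T ρ₀ γ (π e) i] with s hs
  constructor
  simpa [behaviorPolicy] using hs

omit [IsProbabilityMeasure ρ₀] in
theorem measurable_lintegral_behaviorPolicy {f : S × A → ℝ≥0∞} (hf : Measurable f) (i : ℕ) :
    Measurable fun s => ∫⁻ a, f (s, a) ∂(behaviorPolicy T ρ₀ γ π i s) := by
  simp_rw [behaviorPolicy, lintegral_mixture]
  exact Finset.measurable_fun_sum _ fun e _ =>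
    (Measure.measurable_rnDeriv _ _).mul hf.lintegral_kernel_prod_right'

/-- The behavior policy generates, in discounted total from step `i` on, the state-action pairs
of the episodes. This fails for each step separately. -/
theorem tsum_lintegral_behaviorPolicy (hγ0 : 0 < γ) (hγ1 : γ < 1) (i : ℕ)
    {f : S × A → ℝ≥0∞} (hf : Measurable f) :
    ∑' k : ℕ, ENNReal.ofReal ((1 - γ) * γ ^ k) *
        ∑ e, ∫⁻ s, ∫⁻ a, f (s, a) ∂(behaviorPolicy T ρ₀ γ π i s) ∂(stateDist T ρ₀ (π e) (i + k)) =
      ∑' k : ℕ, ENNReal.ofReal ((1 - γ) * γ ^ k) *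
        ∑ e, ∫⁻ z, f z ∂(pairDist T (π e) ρ₀ (i + k)) := by
  have := fun e => isProbabilityMeasure_occupancy T ρ₀ hγ0 hγ1 (π e) i
  have h := lintegral_lintegral_mixture (fun e => occupancy T ρ₀ γ (π e) i) π hf
  rw [lintegral_finsetSum_measure] at h
  simp_rw [lintegral_occupancy] at h
  rw [← Summable.tsum_finsetSum fun _ _ => ENNReal.summable,
    ← Summable.tsum_finsetSum fun _ _ => ENNReal.summable] at h
  simp_rw [← Finset.mul_sum] at h
  refine h.trans (tsum_congr fun k => ?_)
  simp_rw [pairDist_eq_compProd, Measure.lintegral_compProd hf]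

end Occupancy

/-! ### The cancellation argument -/

section Telescoping

/-- Cancellation argument behind the error bound. `H`, `G`, `E`, `D` stand for the expectations at
successive steps of the error under the behavior policy, the error under the episodes' own
actions, the Bellman error and the policy gap; the discounted totals of `H` and `G` agree, and
`G k` is controlled by `E k` and by the next step's `H (k + 1)`. -/
theorem discounted_head_le {γ : ℝ} (hγ0 : 0 < γ) (hγ1 : γ < 1) {H G E D : ℕ → ℝ≥0∞} {V Δ : ℝ≥0∞}
    (hHG : ∑' k : ℕ, ENNReal.ofReal ((1 - γ) * γ ^ k) * H k =
      ∑' k : ℕ, ENNReal.ofReal ((1 - γ) * γ ^ k) * G k)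
    (hG : ∀ k, G k ≤ E k + ENNReal.ofReal γ * (H (k + 1) + D (k + 1)))
    (hV : ∀ k, G k ≤ V) (hVtop : V ≠ ∞) (hD : ∀ k, D k ≤ Δ) (n : ℕ) :
    ENNReal.ofReal (1 - γ) * H 0 ≤
      ∑ k ∈ Finset.range n, ENNReal.ofReal ((1 - γ) * γ ^ k) * (E k + D k) +
        ENNReal.ofReal (γ ^ n) * (V + Δ) := by
  set w : ℕ → ℝ≥0∞ := fun k => ENNReal.ofReal ((1 - γ) * γ ^ k) with hw
  have hw0 : w 0 = ENNReal.ofReal (1 - γ) := by simp [hw]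
  have hws : ∀ k, w k * ENNReal.ofReal γ = w (k + 1) := fun k => by
    rw [hw]
    dsimp only
    rw [← ENNReal.ofReal_mul (mul_nonneg (by linarith) (pow_nonneg hγ0.le k)), pow_succ, mul_assoc]
  have hwadd : ∀ k, w (k + n) = ENNReal.ofReal (γ ^ n) * w k := fun k => by
    rw [hw]
    dsimp only
    rw [← ENNReal.ofReal_mul (pow_nonneg hγ0.le n), pow_add]
    congr 1
    ring
  have hwn : w n ≤ ENNReal.ofReal (γ ^ n) :=
    ENNReal.ofReal_le_ofReal (mul_le_of_le_one_left (pow_nonneg hγ0.le n) (by linarith))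
  have htail : ∑' k, w (k + n) * G (k + n) ≤ ENNReal.ofReal (γ ^ n) * V := by
    calc _ ≤ ∑' k, ENNReal.ofReal (γ ^ n) * (w k * V) :=
          ENNReal.tsum_le_tsum fun k => by
            rw [hwadd, mul_assoc]; gcongr; exact hV _
      _ = _ := by
          rw [ENNReal.tsum_mul_left, ENNReal.tsum_mul_right, tsum_ofReal_geometric hγ0 hγ1, one_mul]
  set R := ∑ k ∈ Finset.range n, w (k + 1) * H (k + 1) with hR
  have hleft : w 0 * H 0 + R ≤ ∑' k, w k * H k := by
    have := ENNReal.sum_le_tsum (f := fun k => w k * H k) (Finset.range (n + 1))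
    rwa [Finset.sum_range_succ', add_comm] at this
  have htot : ∑' k, w k * H k ≠ ∞ := by
    rw [hHG]
    refine ne_top_of_le_ne_top hVtop ?_
    calc _ ≤ ∑' k, w k * V := ENNReal.tsum_le_tsum fun k => by gcongr; exact hV k
      _ = V := by rw [ENNReal.tsum_mul_right, tsum_ofReal_geometric hγ0 hγ1, one_mul]
  have hRtop : R ≠ ∞ := ne_top_of_le_ne_top htot (le_add_self.trans hleft)
  have hDsum : ∑ k ∈ Finset.range n, w (k + 1) * D (k + 1) ≤
      ∑ k ∈ Finset.range n, w k * D k + ENNReal.ofReal (γ ^ n) * Δ := by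
    calc _ ≤ ∑ k ∈ Finset.range (n + 1), w k * D k := by
          rw [Finset.sum_range_succ']; exact le_self_add
      _ ≤ _ := by
          rw [Finset.sum_range_succ]
          gcongr
          exact hD n
  have hhead : ∑ k ∈ Finset.range n, w k * G k ≤
      ∑ k ∈ Finset.range n, w k * E k + R + ∑ k ∈ Finset.range n, w (k + 1) * D (k + 1) := by
    rw [hR, ← Finset.sum_add_distrib, ← Finset.sum_add_distrib]
    refine Finset.sum_le_sum fun k _ => ?_
    calc w k * G k ≤ w k * (E k + ENNReal.ofReal γ * (H (k + 1) + D (k + 1))) := by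
          gcongr; exact hG k
      _ = _ := by rw [← hws k]; ring
  rw [← hw0]
  refine (ENNReal.add_le_add_iff_right hRtop).1 ?_
  calc w 0 * H 0 + R ≤ ∑' k, w k * G k := hHG ▸ hleft
    _ = ∑ k ∈ Finset.range n, w k * G k + ∑' k, w (k + n) * G (k + n) :=
        (ENNReal.summable.sum_add_tsum_nat_add' (k := n)).symm
    _ ≤ ∑ k ∈ Finset.range n, w k * E k + R +
          (∑ k ∈ Finset.range n, w k * D k + ENNReal.ofReal (γ ^ n) * Δ) +
          ENNReal.ofReal (γ ^ n) * V := by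
        gcongr
        exact hhead.trans (by gcongr)
    _ = _ := by simp_rw [mul_add, Finset.sum_add_distrib]; ring

end Telescoping

/-! ### The Wasserstein distance and Lipschitz functions -/

section Wasserstein

variable {A : Type*} [MetricSpace A] [SecondCountableTopology A] [MeasurableSpace A] [BorelSpace A]

/-- The easy half of Kantorovich duality, for the function `‖g‖`. -/
theorem lintegral_enorm_sub_le_wasserstein {g : A → ℝ} (hg : Measurable g) {K : ℝ≥0}
    (hK : LipschitzWith K g) (μ ν : Measure A) [IsProbabilityMeasure μ] [IsProbabilityMeasure ν] :
    ∫⁻ a, ‖g a‖ₑ ∂μ - ∫⁻ a, ‖g a‖ₑ ∂ν ≤ K * wasserstein μ ν := by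
  have key : ∀ κ : Measure (A × A), κ.fst = μ ∧ κ.snd = ν →
      ∫⁻ a, ‖g a‖ₑ ∂μ - ∫⁻ a, ‖g a‖ₑ ∂ν ≤ K * ∫⁻ p, edist p.1 p.2 ∂κ := by
    rintro κ ⟨rfl, rfl⟩
    rw [tsub_le_iff_left, Measure.fst, Measure.snd, lintegral_map hg.enorm measurable_fst,
      lintegral_map hg.enorm measurable_snd, ← lintegral_const_mul _ (by fun_prop),
      ← lintegral_add_left (by fun_prop)]
    refine lintegral_mono fun p => ?_
    calc ‖g p.1‖ₑ = ‖g p.2 + (g p.1 - g p.2)‖ₑ := by congr 1; ring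
      _ ≤ ‖g p.2‖ₑ + ‖g p.1 - g p.2‖ₑ := enorm_add_le _ _
      _ ≤ _ := by
          gcongr
          rw [← edist_eq_enorm_sub]
          exact hK p.1 p.2
  rcases eq_or_ne K 0 with rfl | hK0
  · simpa using key (μ.prod ν) ⟨by simp, by simp⟩
  · have hK0' : (K : ℝ≥0∞) ≠ 0 := by simpa using hK0
    rw [mul_comm, ← ENNReal.div_le_iff hK0' ENNReal.coe_ne_top]
    exact le_iInf₂ fun κ hκ => by
      rw [ENNReal.div_le_iff hK0' ENNReal.coe_ne_top, mul_comm]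
      exact key κ hκ

omit [BorelSpace A] in
theorem wasserstein_le_diam (hA : Bornology.IsBounded (Set.univ : Set A)) (μ ν : Measure A)
    [IsProbabilityMeasure μ] [IsProbabilityMeasure ν] :
    wasserstein μ ν ≤ ENNReal.ofReal (Metric.diam (Set.univ : Set A)) := by
  refine (iInf₂_le (μ.prod ν) ⟨by simp, by simp⟩).trans ?_
  calc _ ≤ ∫⁻ _, ENNReal.ofReal (Metric.diam (Set.univ : Set A)) ∂(μ.prod ν) :=
        lintegral_mono fun p => by
          rw [edist_dist]
          exact ENNReal.ofReal_le_ofReal (Metric.dist_le_diam_of_mem hA trivial trivial)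
    _ = _ := by simp

end Wasserstein

/-! ### The deterministic error bound -/

section EvaluationError

variable {S A : Type*} [MeasurableSpace S] [MeasurableSpace A]
  (T : Kernel (S × A) S) [IsMarkovKernel T] (ρ₀ : Measure S) [IsProbabilityMeasure ρ₀]
  {γ : ℝ} {N : ℕ} (π : Fin N → Kernel S A) [∀ e, IsMarkovKernel (π e)]
  (πN : Kernel S A) [IsMarkovKernel πN]

omit [IsMarkovKernel T] [IsMarkovKernel πN] in
/-- The recursion `|g| ≤ |b| + γ 𝔼|g|` for a function satisfying a Bellman equation with
right-hand side `b`. -/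
theorem enorm_le_of_bellman [IsSFiniteKernel T] [IsSFiniteKernel πN] (hγ0 : 0 < γ)
    {g b : S × A → ℝ} (hg : Measurable g)
    (hgb : ∀ z, g z = b z + γ * ∫ y, g y ∂(transition T πN z)) (z : S × A) :
    ‖g z‖ₑ ≤ ‖b z‖ₑ + ENNReal.ofReal γ * ∫⁻ s, ∫⁻ a, ‖g (s, a)‖ₑ ∂(πN s) ∂(T z) := by
  have h : ∫⁻ s, ∫⁻ a, ‖g (s, a)‖ₑ ∂(πN s) ∂(T z) = ∫⁻ y, ‖g y‖ₑ ∂(transition T πN z) := by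
    rw [transition, Kernel.lintegral_compProd _ _ _ hg.enorm]
    rfl
  rw [h]
  calc ‖g z‖ₑ = ‖b z + γ * ∫ y, g y ∂(transition T πN z)‖ₑ := by rw [← hgb]
    _ ≤ ‖b z‖ₑ + ‖γ * ∫ y, g y ∂(transition T πN z)‖ₑ := enorm_add_le _ _
    _ ≤ _ := by
        rw [enorm_mul, Real.enorm_of_nonneg hγ0.le]
        gcongr
        exact enorm_integral_le_lintegral_enorm _

theorem sum_lintegral_le {E : Type*} [MeasurableSpace E] (μ : Fin N → Measure E)
    [∀ e, IsProbabilityMeasure (μ e)] {f : E → ℝ≥0∞} {c : ℝ≥0∞} (hf : ∀ z, f z ≤ c) :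
    ∑ e, ∫⁻ z, f z ∂(μ e) ≤ N * c := by
  calc _ ≤ ∑ _e : Fin N, c := Finset.sum_le_sum fun e _ => by
        simpa using lintegral_mono (μ := μ e) (g := fun _ => c) hf
    _ = _ := by simp

/-- Integrated form of the recursion `|g| ≤ |b| + γ 𝔼|g|` along the trajectories of a policy `π₁`:
the expectation of `|g|` under `πN` at the next state is replaced by `h + D`. -/
theorem lintegral_pairDist_le (π₁ : Kernel S A) [IsMarkovKernel π₁] (hγ0 : 0 < γ)
    {g b : S × A → ℝ} (hg : Measurable g) (hb : Measurable b)
    (hgb : ∀ z, g z = b z + γ * ∫ y, g y ∂(transition T πN z))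
    {h : S → ℝ≥0∞} (hh : Measurable h) {D : S → ℝ} (j : ℕ)
    (hgap : ∀ᵐ s ∂(stateDist T ρ₀ π₁ (j + 1)),
      ∫⁻ a, ‖g (s, a)‖ₑ ∂(πN s) ≤ h s + ENNReal.ofReal (D s)) :
    ∫⁻ z, ‖g z‖ₑ ∂(pairDist T π₁ ρ₀ j) ≤ ∫⁻ z, ‖b z‖ₑ ∂(pairDist T π₁ ρ₀ j) +
      ENNReal.ofReal γ * (∫⁻ s, h s ∂(stateDist T ρ₀ π₁ (j + 1)) +
        ∫⁻ s, ENNReal.ofReal (D s) ∂(stateDist T ρ₀ π₁ (j + 1))) := by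
  have hmm : Measurable fun s => ∫⁻ a, ‖g (s, a)‖ₑ ∂(πN s) :=
    Measurable.lintegral_kernel_prod_right' (f := fun z : S × A => ‖g z‖ₑ) hg.enorm
  calc _ ≤ ∫⁻ z, (‖b z‖ₑ + ENNReal.ofReal γ * ∫⁻ s, ∫⁻ a, ‖g (s, a)‖ₑ ∂(πN s) ∂(T z))
          ∂(pairDist T π₁ ρ₀ j) :=
        lintegral_mono fun z => enorm_le_of_bellman T πN hγ0 hg hgb z
    _ = ∫⁻ z, ‖b z‖ₑ ∂(pairDist T π₁ ρ₀ j) + ENNReal.ofReal γ *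
          ∫⁻ s, ∫⁻ a, ‖g (s, a)‖ₑ ∂(πN s) ∂(stateDist T ρ₀ π₁ (j + 1)) := by
        rw [lintegral_add_left hb.enorm, lintegral_const_mul' _ _ ENNReal.ofReal_ne_top,
          stateDist_succ, Measure.lintegral_bind (Kernel.aemeasurable _) hmm.aemeasurable]
    _ ≤ _ := by
        gcongr
        rw [← lintegral_add_left hh]
        exact lintegral_mono_ae hgap

/-- The deterministic part of the error bound. Here `D` is any measurable bound for the
discrepancy between the target policy and the behavior policy as seen by `|g|`. -/
theorem integral_behaviorPolicy_le (hγ0 : 0 < γ) (hγ1 : γ < 1) (hN : 0 < N)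
    {g b : S × A → ℝ} (hg : Measurable g) (hb : Measurable b)
    (hgb : ∀ z, g z = b z + γ * ∫ y, g y ∂(transition T πN z))
    {V M Δ : ℝ} (hV : ∀ z, |g z| ≤ V) (hM : ∀ z, |b z| ≤ M)
    {D : S → ℝ} (hD : Measurable D) (hD0 : ∀ s, 0 ≤ D s) (hDΔ : ∀ s, D s ≤ Δ) {i : ℕ}
    (hgap : ∀ᵐ s ∂(∑ e, occupancy T ρ₀ γ (π e) i), ∫⁻ a, ‖g (s, a)‖ₑ ∂(πN s) ≤
      ∫⁻ a, ‖g (s, a)‖ₑ ∂(behaviorPolicy T ρ₀ γ π i s) + ENNReal.ofReal (D s)) (n : ℕ) :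
    (1 - γ) * ∫ s, ∫ a, |g (s, a)| ∂(behaviorPolicy T ρ₀ γ π i s) ∂(avgStateDist T ρ₀ π i) ≤
      (N : ℝ)⁻¹ * ∑ e, ∑ k ∈ Finset.range n,
        (1 - γ) * γ ^ k * ∫ z, (|b z| + D z.1) ∂(pairDist T (π e) ρ₀ (i + k)) +
        γ ^ n * (V + Δ) := by
  obtain ⟨s₀⟩ : Nonempty S := nonempty_of_isProbabilityMeasure ρ₀
  obtain ⟨a₀⟩ : Nonempty A := nonempty_of_isProbabilityMeasure (πN s₀)
  have hV0 : 0 ≤ V := (abs_nonneg _).trans (hV (s₀, a₀))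
  have hΔ0 : 0 ≤ Δ := (hD0 s₀).trans (hDΔ s₀)
  have hN' : (0 : ℝ) < N := by exact_mod_cast hN
  have hw : ∀ k : ℕ, 0 ≤ (1 - γ) * γ ^ k := fun k =>
    mul_nonneg (by linarith) (pow_nonneg hγ0.le k)
  set h : S → ℝ≥0∞ := fun s => ∫⁻ a, ‖g (s, a)‖ₑ ∂(behaviorPolicy T ρ₀ γ π i s) with hh
  have hhm : Measurable h := measurable_lintegral_behaviorPolicy T ρ₀ π hg.enorm i
  have hrec : ∀ k, ∑ e, ∫⁻ z, ‖g z‖ₑ ∂(pairDist T (π e) ρ₀ (i + k)) ≤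
      ∑ e, ∫⁻ z, ‖b z‖ₑ ∂(pairDist T (π e) ρ₀ (i + k)) + ENNReal.ofReal γ *
        (∑ e, ∫⁻ s, h s ∂(stateDist T ρ₀ (π e) (i + (k + 1))) +
          ∑ e, ∫⁻ s, ENNReal.ofReal (D s) ∂(stateDist T ρ₀ (π e) (i + (k + 1)))) := by
    intro k
    rw [← Finset.sum_add_distrib, Finset.mul_sum, ← Finset.sum_add_distrib]
    exact Finset.sum_le_sum fun e _ => lintegral_pairDist_le T ρ₀ πN (π e) hγ0 hg hb hgb hhm
      (i + k) (ae_stateDist_of_ae_sum_occupancy T ρ₀ π hγ0 hγ1 hgap e (k + 1))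
  have hmain := discounted_head_le hγ0 hγ1
    (H := fun k => ∑ e, ∫⁻ s, h s ∂(stateDist T ρ₀ (π e) (i + k)))
    (G := fun k => ∑ e, ∫⁻ z, ‖g z‖ₑ ∂(pairDist T (π e) ρ₀ (i + k)))
    (E := fun k => ∑ e, ∫⁻ z, ‖b z‖ₑ ∂(pairDist T (π e) ρ₀ (i + k)))
    (D := fun k => ∑ e, ∫⁻ s, ENNReal.ofReal (D s) ∂(stateDist T ρ₀ (π e) (i + k)))
    (tsum_lintegral_behaviorPolicy T ρ₀ π hγ0 hγ1 i hg.enorm) hrec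
    (V := N * ENNReal.ofReal V) (Δ := N * ENNReal.ofReal Δ)
    (fun k => sum_lintegral_le (fun e => pairDist T (π e) ρ₀ (i + k)) fun z => by
      rw [Real.enorm_eq_ofReal_abs]; exact ENNReal.ofReal_le_ofReal (hV z))
    (by finiteness)
    (fun k => sum_lintegral_le (fun e => stateDist T ρ₀ (π e) (i + k)) fun s =>
      ENNReal.ofReal_le_ofReal (hDΔ s)) n
  have hφi : ∀ e k, Integrable (fun z => |b z| + D z.1) (pairDist T (π e) ρ₀ (i + k)) :=
    fun e k => Integrable.of_bound (by fun_prop) (M + Δ) (ae_of_all _ fun z => by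
      rw [Real.norm_of_nonneg (add_nonneg (abs_nonneg _) (hD0 _))]
      exact add_le_add (hM z) (hDΔ _))
  have hterm : ∀ k, ∑ e, ∫⁻ z, ‖b z‖ₑ ∂(pairDist T (π e) ρ₀ (i + k)) +
      ∑ e, ∫⁻ s, ENNReal.ofReal (D s) ∂(stateDist T ρ₀ (π e) (i + k)) =
      ENNReal.ofReal (∑ e, ∫ z, (|b z| + D z.1) ∂(pairDist T (π e) ρ₀ (i + k))) := by
    intro k
    rw [ENNReal.ofReal_sum_of_nonneg fun e _ => integral_nonneg fun z =>
      add_nonneg (abs_nonneg _) (hD0 _), ← Finset.sum_add_distrib]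
    refine Finset.sum_congr rfl fun e _ => ?_
    rw [ofReal_integral_eq_lintegral_ofReal (hφi e k)
      (ae_of_all _ fun z => add_nonneg (abs_nonneg _) (hD0 _)), ← fst_pairDist, Measure.fst,
      lintegral_map (by fun_prop) measurable_fst, ← lintegral_add_left hb.enorm]
    refine lintegral_congr fun z => ?_
    rw [ENNReal.ofReal_add (abs_nonneg _) (hD0 _), Real.enorm_eq_ofReal_abs]
  set R : ℝ := ∑ k ∈ Finset.range n, (1 - γ) * γ ^ k *
    ∑ e, ∫ z, (|b z| + D z.1) ∂(pairDist T (π e) ρ₀ (i + k)) with hR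
  have hR0 : ∀ k ∈ Finset.range n, 0 ≤ (1 - γ) * γ ^ k *
      ∑ e, ∫ z, (|b z| + D z.1) ∂(pairDist T (π e) ρ₀ (i + k)) := fun k _ =>
    mul_nonneg (hw k) (Finset.sum_nonneg fun e _ => integral_nonneg fun z =>
      add_nonneg (abs_nonneg _) (hD0 _))
  have hrhs : ENNReal.ofReal (1 - γ) * ∑ e, ∫⁻ s, h s ∂(stateDist T ρ₀ (π e) i) ≤
      ENNReal.ofReal (R + γ ^ n * (N * (V + Δ))) := by
    beta_reduce at hmain
    rw [add_zero] at hmain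
    refine hmain.trans (le_of_eq ?_)
    simp_rw [hterm, ← ENNReal.ofReal_mul (hw _)]
    rw [← ENNReal.ofReal_sum_of_nonneg hR0, ← mul_add, ← ENNReal.ofReal_add hV0 hΔ0,
      ← ENNReal.ofReal_natCast, ← ENNReal.ofReal_mul hN'.le,
      ← ENNReal.ofReal_mul (pow_nonneg hγ0.le n), ← ENNReal.ofReal_add
      (Finset.sum_nonneg hR0) (mul_nonneg (pow_nonneg hγ0.le n) (by positivity))]
  have hfin : ∑ e, ∫⁻ s, h s ∂(stateDist T ρ₀ (π e) i) ≠ ∞ := fun htop => by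
    rw [htop, ENNReal.mul_top (by simpa using hγ1)] at hrhs
    exact absurd (top_le_iff.1 hrhs) ENNReal.ofReal_ne_top
  have hreal : (1 - γ) * (∑ e, ∫⁻ s, h s ∂(stateDist T ρ₀ (π e) i)).toReal ≤
      R + γ ^ n * (N * (V + Δ)) := by
    have h1 := ENNReal.toReal_mono ENNReal.ofReal_ne_top hrhs
    rwa [ENNReal.toReal_mul, ENNReal.toReal_ofReal (by linarith), ENNReal.toReal_ofReal
      (add_nonneg (Finset.sum_nonneg hR0)
        (mul_nonneg (pow_nonneg hγ0.le n) (by positivity)))] at h1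
  have hinner : ∀ s, ∫ a, |g (s, a)| ∂(behaviorPolicy T ρ₀ γ π i s) = (h s).toReal := fun s =>
    integral_norm_eq_lintegral_enorm (hg.comp measurable_prodMk_left).aestronglyMeasurable
  have havg : ∫⁻ s, h s ∂(avgStateDist T ρ₀ π i) =
      (N : ℝ≥0∞)⁻¹ * ∑ e, ∫⁻ s, h s ∂(stateDist T ρ₀ (π e) i) := by
    rw [avgStateDist, lintegral_smul_measure, lintegral_finsetSum_measure]
    rfl
  have hlhs : ∫ s, ∫ a, |g (s, a)| ∂(behaviorPolicy T ρ₀ γ π i s) ∂(avgStateDist T ρ₀ π i) =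
      (N : ℝ)⁻¹ * (∑ e, ∫⁻ s, h s ∂(stateDist T ρ₀ (π e) i)).toReal := by
    have hNinv : (N : ℝ≥0∞)⁻¹ ≠ ∞ := ENNReal.inv_ne_top.2 (by exact_mod_cast hN.ne')
    simp_rw [hinner]
    rw [integral_toReal hhm.aemeasurable
      (ae_lt_top hhm (by rw [havg]; exact ENNReal.mul_ne_top hNinv hfin)), havg,
      ENNReal.toReal_mul, ENNReal.toReal_inv, ENNReal.toReal_natCast]
  have hswap : R = ∑ e, ∑ k ∈ Finset.range n,
      (1 - γ) * γ ^ k * ∫ z, (|b z| + D z.1) ∂(pairDist T (π e) ρ₀ (i + k)) := by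
    rw [hR, Finset.sum_comm]
    simp_rw [Finset.mul_sum]
  rw [hlhs, ← hswap]
  calc _ = (N : ℝ)⁻¹ * ((1 - γ) * (∑ e, ∫⁻ s, h s ∂(stateDist T ρ₀ (π e) i)).toReal) := by ring
    _ ≤ (N : ℝ)⁻¹ * (R + γ ^ n * (N * (V + Δ))) := by gcongr
    _ = _ := by field_simp

end EvaluationError

/-! ### Concentration of independent means -/

section Concentration

/-- One-sided Hoeffding inequality for the mean of independent `[0, M]`-valued variables. The
strict inequality makes the statement hold for `M = 0` as well. -/
theorem measure_mean_add_lt_le_exp {Ω : Type*} [MeasurableSpace Ω] {P : Measure Ω}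
    [IsProbabilityMeasure P] {N : ℕ} (hN : 0 < N) {Y : Fin N → Ω → ℝ}
    (hY : ∀ e, AEMeasurable (Y e) P) (hind : iIndepFun Y P) {M : ℝ}
    (hYM : ∀ e ω, Y e ω ∈ Set.Icc 0 M) {l : ℝ} (hl : 0 ≤ l) :
    P {ω | (N : ℝ)⁻¹ * ∑ e, Y e ω + M * √(l / (2 * N)) < (N : ℝ)⁻¹ * ∑ e, ∫ ω, Y e ω ∂P} ≤
      ENNReal.ofReal (Real.exp (-l)) := by
  have hN' : (0 : ℝ) < N := by exact_mod_cast hN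
  obtain ⟨ω₀⟩ : Nonempty Ω := nonempty_of_isProbabilityMeasure P
  have hM0 : 0 ≤ M := (hYM ⟨0, hN⟩ ω₀).1.trans (hYM ⟨0, hN⟩ ω₀).2
  rcases hM0.eq_or_lt with rfl | hM
  · have hz : ∀ e ω, Y e ω = 0 := fun e ω => le_antisymm (hYM e ω).2 (hYM e ω).1
    simp [hz]
  have hsub : ∀ e ∈ Finset.univ, HasSubgaussianMGF (fun ω => -(Y e ω - ∫ ω, Y e ω ∂P))
      ((‖M - 0‖₊ / 2) ^ 2) P := fun e _ =>
    (hasSubgaussianMGF_of_mem_Icc (hY e) (ae_of_all _ (hYM e))).neg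
  have hind' : iIndepFun (fun e ω => -(Y e ω - ∫ ω, Y e ω ∂P)) P :=
    hind.comp (fun e y => -(y - ∫ ω, Y e ω ∂P)) fun e => by fun_prop
  have h := HasSubgaussianMGF.measure_sum_ge_le_of_iIndepFun hind' hsub
    (ε := N * (M * √(l / (2 * N)))) (by positivity)
  have hexp : -(N * (M * √(l / (2 * N)))) ^ 2 /
      (2 * ∑ e : Fin N, (((‖M - 0‖₊ / 2) ^ 2 : ℝ≥0) : ℝ)) = -l := by
    have hc : (((‖M - 0‖₊ / 2) ^ 2 : ℝ≥0) : ℝ) = (M / 2) ^ 2 := by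
      simp [abs_of_pos hM]
    rw [hc, mul_pow, mul_pow, Real.sq_sqrt (by positivity), Finset.sum_const, Finset.card_univ,
      Fintype.card_fin, nsmul_eq_mul]
    field_simp
  push_cast at hexp h
  rw [hexp] at h
  calc _ ≤ P {ω | N * (M * √(l / (2 * N))) ≤ ∑ e, -(Y e ω - ∫ ω, Y e ω ∂P)} := by
        refine measure_mono fun ω hω => ?_
        rw [Set.mem_ofPred_eq] at hω ⊢
        rw [Finset.sum_neg_distrib, Finset.sum_sub_distrib]
        have h1 := mul_lt_mul_of_pos_left hω hN'
        rw [mul_add, mul_inv_cancel_left₀ hN'.ne', mul_inv_cancel_left₀ hN'.ne'] at h1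
        linarith
    _ ≤ _ := by
        rw [← ofReal_measureReal]
        exact ENNReal.ofReal_le_ofReal h

end Concentration

/-! ### Averages over the buffer -/

section BufferAverage

variable {S A : Type*}

theorem bufferAvg_mono {N L : ℕ} {γ : ℝ} (hγ0 : 0 < γ) (hγ1 : γ < 1) {i : ℕ}
    {x : Fin N → Fin L → S × A} {f f' : S → A → ℝ}
    (h : ∀ e, ∀ j : Fin L, i ≤ (j : ℕ) → f (x e j).1 (x e j).2 ≤ f' (x e j).1 (x e j).2) :
    bufferAvg γ i x f ≤ bufferAvg γ i x f' := by
  refine mul_le_mul_of_nonneg_left (Finset.sum_le_sum fun e _ => Finset.sum_le_sum fun j hj =>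
    mul_le_mul_of_nonneg_left (h e j (Finset.mem_filter.1 hj).2) ?_) (by positivity)
  exact mul_nonneg (by linarith) (pow_nonneg hγ0.le _)

theorem bufferAvg_add_const_mul {N L : ℕ} (γ : ℝ) (i : ℕ) (x : Fin N → Fin L → S × A)
    (f f' : S → A → ℝ) (c : ℝ) :
    bufferAvg γ i x (fun s a => f s a + c * f' s a) =
      bufferAvg γ i x f + c * bufferAvg γ i x f' := by
  simp only [bufferAvg, mul_add, Finset.sum_add_distrib, Finset.mul_sum]
  congr 1
  exact Finset.sum_congr rfl fun e _ => Finset.sum_congr rfl fun j _ => by ring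

theorem bufferAvg_nonneg {N L : ℕ} {γ : ℝ} (hγ0 : 0 < γ) (hγ1 : γ < 1) (i : ℕ)
    (x : Fin N → Fin L → S × A) {f : S → A → ℝ} (hf : ∀ s a, 0 ≤ f s a) :
    0 ≤ bufferAvg γ i x f := by
  have := bufferAvg_mono hγ0 hγ1 (i := i) (x := x) (f := 0) (f' := f) fun e j _ => hf _ _
  simpa [bufferAvg] using this

end BufferAverage

/-! ### Sampled trajectories -/

section Buffer

variable {S A : Type*} [MeasurableSpace S] [MeasurableSpace A]

theorem sum_filter_le_fin (L i : ℕ) (f : ℕ → ℝ) :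
    ∑ j ∈ Finset.univ.filter (fun j : Fin L => i ≤ (j : ℕ)), f j =
      ∑ k ∈ Finset.range (L - i), f (i + k) := by
  rw [Finset.sum_filter, Fin.sum_univ_eq_sum_range (fun j => if i ≤ j then f j else 0),
    ← Finset.sum_filter, ← Finset.sum_Ico_eq_sum_range]
  congr 1
  ext j
  simp [and_comm]

/-- The discounted sum of `φ` along a single trajectory of length `L`, from step `i` on. -/
noncomputable def discountedSum {L : ℕ} (γ : ℝ) (i : ℕ) (φ : S × A → ℝ) (x : Fin L → S × A) : ℝ :=
  ∑ j ∈ Finset.univ.filter (fun j : Fin L => i ≤ (j : ℕ)), (1 - γ) * γ ^ ((j : ℕ) - i) * φ (x j)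

theorem measurable_discountedSum {L : ℕ} {γ : ℝ} {i : ℕ} {φ : S × A → ℝ} (hφ : Measurable φ) :
    Measurable (discountedSum (L := L) γ i φ) := by
  unfold discountedSum
  fun_prop

omit [MeasurableSpace S] [MeasurableSpace A] in
theorem discountedSum_mem_Icc {L : ℕ} {γ : ℝ} (hγ0 : 0 < γ) (hγ1 : γ < 1) {i : ℕ}
    {φ : S × A → ℝ} {M : ℝ} (hM : 0 ≤ M) (hφ : ∀ z, φ z ∈ Set.Icc 0 M) (x : Fin L → S × A) :
    discountedSum γ i φ x ∈ Set.Icc 0 M := by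
  have hw : ∀ k : ℕ, 0 ≤ (1 - γ) * γ ^ k := fun k =>
    mul_nonneg (by linarith) (pow_nonneg hγ0.le k)
  refine ⟨Finset.sum_nonneg fun j _ => mul_nonneg (hw _) (hφ _).1, ?_⟩
  calc discountedSum γ i φ x
      ≤ ∑ j ∈ Finset.univ.filter (fun j : Fin L => i ≤ (j : ℕ)),
          (1 - γ) * γ ^ ((j : ℕ) - i) * M :=
        Finset.sum_le_sum fun j _ => mul_le_mul_of_nonneg_left (hφ _).2 (hw _)
    _ = (∑ k ∈ Finset.range (L - i), (1 - γ) * γ ^ k) * M := by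
        rw [← Finset.sum_mul, sum_filter_le_fin L i fun j => (1 - γ) * γ ^ (j - i)]
        simp
    _ ≤ 1 * M := by
        gcongr
        rw [← Finset.mul_sum, mul_neg_geom_sum]
        linarith [pow_pos hγ0 (L - i)]
    _ = M := one_mul M

theorem integral_discountedSum {L : ℕ} {γ : ℝ} {i : ℕ} {φ : S × A → ℝ}
    (hφ : Measurable φ) {M : ℝ} (hM : ∀ z, φ z ∈ Set.Icc 0 M)
    (T : Kernel (S × A) S) [IsMarkovKernel T] (ρ₀ : Measure S) [IsProbabilityMeasure ρ₀]
    (π : Kernel S A) [IsMarkovKernel π] :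
    ∫ x, discountedSum γ i φ x ∂(episodeLaw T ρ₀ π L) =
      ∑ k ∈ Finset.range (L - i), (1 - γ) * γ ^ k * ∫ z, φ z ∂(pairDist T π ρ₀ (i + k)) := by
  have hm : Measurable fun (x : ℕ → S × A) (j : Fin L) => x j := by fun_prop
  rw [episodeLaw, integral_map hm.aemeasurable
    (measurable_discountedSum hφ).aestronglyMeasurable]
  unfold discountedSum
  rw [integral_finsetSum]
  · simp_rw [integral_const_mul]
    rw [sum_filter_le_fin L i fun j => (1 - γ) * γ ^ (j - i) * ∫ x, φ (x j) ∂(trajectory T ρ₀ π)]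
    refine Finset.sum_congr rfl fun k _ => ?_
    rw [pairDist, integral_map (measurable_pi_apply _).aemeasurable hφ.aestronglyMeasurable,
      Nat.add_sub_cancel_left]
  · exact fun j _ => (Integrable.of_mem_Icc 0 M
      (hφ.comp (measurable_pi_apply _)).aemeasurable (ae_of_all _ fun x => hM _)).const_mul _

/-- The expectation of a buffer average is exceeded only with small probability. -/
theorem measure_bufferAvg_add_lt {Ω : Type*} [MeasurableSpace Ω] {P : Measure Ω}
    [IsProbabilityMeasure P] (T : Kernel (S × A) S) [IsMarkovKernel T] (ρ₀ : Measure S)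
    [IsProbabilityMeasure ρ₀] {γ : ℝ} (hγ0 : 0 < γ) (hγ1 : γ < 1) {N : ℕ} (hN : 0 < N)
    (π : Fin N → Kernel S A) [∀ e, IsMarkovKernel (π e)] {L : ℕ} {X : Fin N → Ω → Fin L → S × A}
    (hX : ∀ e, HasLaw (X e) (episodeLaw T ρ₀ (π e) L) P) (hind : iIndepFun X P)
    {φ : S × A → ℝ} (hφ : Measurable φ) {M : ℝ} (hM0 : 0 ≤ M) (hM : ∀ z, φ z ∈ Set.Icc 0 M)
    (i : ℕ) {δ : ℝ} (hδ0 : 0 < δ) (hδ1 : δ < 1) :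
    P {ω | bufferAvg γ i (fun e => X e ω) (fun s a => φ (s, a)) +
        M * √(Real.log (2 / δ) / (2 * N)) <
        (N : ℝ)⁻¹ * ∑ e, ∑ k ∈ Finset.range (L - i),
          (1 - γ) * γ ^ k * ∫ z, φ z ∂(pairDist T (π e) ρ₀ (i + k))} < ENNReal.ofReal δ := by
  have hl : 0 ≤ Real.log (2 / δ) :=
    Real.log_nonneg ((one_le_div hδ0).2 (by linarith))
  have h := measure_mean_add_lt_le_exp hN (P := P) (Y := fun e ω => discountedSum γ i φ (X e ω))
    (fun e => (measurable_discountedSum hφ).comp_aemeasurable (hX e).aemeasurable)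
    (hind.comp (fun _ => discountedSum γ i φ) fun _ => measurable_discountedSum hφ)
    (fun e ω => discountedSum_mem_Icc hγ0 hγ1 hM0 hM (X e ω)) hl
  have hint : ∀ e, ∫ ω, discountedSum γ i φ (X e ω) ∂P = ∑ k ∈ Finset.range (L - i),
      (1 - γ) * γ ^ k * ∫ z, φ z ∂(pairDist T (π e) ρ₀ (i + k)) := fun e => by
    rw [← integral_discountedSum hφ hM, ← (hX e).map_eq, integral_map (hX e).aemeasurable
      (measurable_discountedSum hφ).aestronglyMeasurable]
  simp_rw [hint] at h
  refine h.trans_lt ?_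
  rw [Real.exp_neg, Real.exp_log (by positivity), ENNReal.ofReal_lt_ofReal_iff hδ0, inv_div]
  linarith

/-- Properties holding almost everywhere for the total occupancy measure hold almost surely along
the buffer, from step `i` on. -/
theorem ae_forall_buffer {Ω : Type*} [MeasurableSpace Ω] {P : Measure Ω}
    (T : Kernel (S × A) S) [IsMarkovKernel T] (ρ₀ : Measure S)
    {γ : ℝ} (hγ0 : 0 < γ) (hγ1 : γ < 1) {N : ℕ}
    (π : Fin N → Kernel S A) [∀ e, IsMarkovKernel (π e)] {L : ℕ} {X : Fin N → Ω → Fin L → S × A}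
    (hX : ∀ e, HasLaw (X e) (episodeLaw T ρ₀ (π e) L) P) {i : ℕ} {p : S → Prop}
    (hp : ∀ᵐ s ∂(∑ e, occupancy T ρ₀ γ (π e) i), p s) :
    ∀ᵐ ω ∂P, ∀ e, ∀ j : Fin L, i ≤ (j : ℕ) → p (X e ω j).1 := by
  rw [ae_all_iff]
  intro e
  rw [ae_all_iff]
  intro j
  by_cases hij : i ≤ (j : ℕ)
  · obtain ⟨k, hk⟩ := Nat.exists_eq_add_of_le hij
    have h := ae_stateDist_of_ae_sum_occupancy T ρ₀ π hγ0 hγ1 hp e k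
    have hm : Measurable fun (x : ℕ → S × A) (j : Fin L) => x j := by fun_prop
    have hmj : Measurable fun x : Fin L → S × A => (x j).1 := by fun_prop
    have hlaw : stateDist T ρ₀ (π e) (i + k) = P.map (fun ω => (X e ω j).1) := by
      have : P.map (fun ω => (X e ω j).1) = (P.map (X e)).map fun x => (x j).1 :=
        (AEMeasurable.map_map_of_aemeasurable hmj.aemeasurable (hX e).aemeasurable).symm
      rw [this, (hX e).map_eq, episodeLaw, Measure.map_map hmj hm, stateDist, ← hk]
      rfl
    rw [hlaw] at h
    filter_upwards [ae_of_ae_map (hmj.comp_aemeasurable (hX e).aemeasurable) h] with ω hω _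
    exact hω
  · exact ae_of_all _ fun ω h => absurd h hij

end Buffer

/-! ### The Bellman residual -/

section BellmanResidual

variable {S A : Type*} [MeasurableSpace S] [MeasurableSpace A]
  (T : Kernel (S × A) S) [IsMarkovKernel T] (π : Kernel S A) [IsMarkovKernel π]
  {r : S → A → ℝ} {γ B : ℝ}

omit [IsMarkovKernel T] in
theorem measurable_bellman (hr : Measurable (Function.uncurry r)) {Q : S → A → ℝ}
    (hQ : Measurable (Function.uncurry Q)) :
    Measurable (Function.uncurry (bellman T r γ π Q)) := by
  have h1 : Measurable fun s' => ∫ a', Q s' a' ∂(π s') :=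
    (hQ.stronglyMeasurable.integral_kernel_prod_right' (κ := π)).measurable
  have h2 : Measurable fun z => ∫ s', ∫ a', Q s' a' ∂(π s') ∂(T z) :=
    (h1.stronglyMeasurable.integral_kernel (κ := T)).measurable
  exact hr.add (h2.const_mul γ)

/-- The error `Q - Q^π` satisfies the Bellman equation with the Bellman residual of `Q` as
reward. -/
theorem sub_qFunction_eq (hr : Measurable (Function.uncurry r)) (hB : ∀ s a, |r s a| ≤ B)
    (hγ0 : 0 < γ) (hγ1 : γ < 1) {Q : S → A → ℝ} (hQ : Measurable (Function.uncurry Q)) {V : ℝ}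
    (hQV : ∀ s a, Q s a ∈ Set.Icc 0 V) (hqV : ∀ s a, qFunction T r γ π s a ∈ Set.Icc 0 V)
    (z : S × A) :
    Q z.1 z.2 - qFunction T r γ π z.1 z.2 = (Q z.1 z.2 - bellman T r γ π Q z.1 z.2) +
      γ * ∫ y, (Q y.1 y.2 - qFunction T r γ π y.1 y.2) ∂(transition T π z) := by
  have hi : Integrable (Function.uncurry Q) (transition T π z) :=
    Integrable.of_mem_Icc 0 V hQ.aemeasurable (ae_of_all _ fun y => hQV y.1 y.2)
  have hi' : Integrable (Function.uncurry (qFunction T r γ π)) (transition T π z) :=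
    Integrable.of_mem_Icc 0 V (measurable_qFunction T π hr hB hγ0 hγ1).aemeasurable
      (ae_of_all _ fun y => hqV y.1 y.2)
  have h1 := integral_transition T π z hi
  have h2 := qFunction_eq_integral_transition T π hr hB hγ0 hγ1 z
  have h3 := integral_sub hi hi'
  simp only [Function.uncurry] at h1 h3
  rw [h3, h1, bellman]
  linarith

end BellmanResidual

/-! ### Comparison of the bound with its rate -/

section Asymptotic

/-- The explicit high-probability bound is at most `4 √l` times the asymptotic rate, where `l`
stands for `log (2 / δ) ≥ log 2`; the lower bound on `l` lets `√l` absorb the terms that do not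
carry it. -/
theorem bound_le_rate {γ rmax LA c d ε l W E ξ : ℝ} {N n : ℕ} (hN : 0 < N) (hγ1 : γ < 1)
    (hr : 0 ≤ rmax) (hLA : 0 ≤ LA) (hd : 0 ≤ d) (hε : 0 < ε) (hl : Real.log 2 ≤ l) (hW : 0 ≤ W)
    (hE : 0 ≤ E) (hn : γ ^ n ≤ ε) (hγ0 : 0 < γ) (hc : LA = c / (1 - γ)) (hξ : E = ξ / (1 - γ)) :
    rmax / (1 - γ) * √(1 / (2 * N) * l) + (rmax / (1 - γ) ^ 2 + 2 * LA * d / (1 - γ)) *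
        (√(2 / N * l) + γ ^ n) + 1 / (1 - γ) * (E + 2 * LA * W) ≤
      4 * √l * (1 / (1 - γ) ^ 2 * ((rmax + c * d) * (1 / √N + ε) + ξ + c * W)) := by
  have hγ : 0 < 1 - γ := by linarith
  have hN' : (0 : ℝ) < N := by exact_mod_cast hN
  have hl0 : 0 ≤ l := (Real.log_nonneg (by norm_num)).trans hl
  have hc0 : 0 ≤ c := by
    rw [hc] at hLA; by_contra! h; exact absurd hLA (not_le.2 (div_neg_of_neg_of_pos h hγ))
  have hξ0 : 0 ≤ ξ := by
    rw [hξ] at hE; by_contra! h; exact absurd hE (not_le.2 (div_neg_of_neg_of_pos h hγ))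
  set q := √l with hq
  -- `2 q ≥ 1`, so that a factor `2 q` may be inserted in front of any nonnegative term
  have hq2 : 1 / 2 ≤ q := Real.le_sqrt_of_sq_le (by linarith [Real.log_two_gt_d9])
  set u := 1 / √(N : ℝ) with hu
  have hu0 : 0 ≤ u := by positivity
  have h1 : √(1 / (2 * N) * l) ≤ u * q := by
    rw [hu, show 1 / √(N : ℝ) = √(1 / N) by simp, hq, ← Real.sqrt_mul (by positivity)]
    apply Real.sqrt_le_sqrt
    gcongr
    linarith
  have h2 : √(2 / N * l) ≤ 2 * (u * q) := by
    rw [show (2 : ℝ) / N * l = 2 * (1 / N * l) by ring, Real.sqrt_mul (by norm_num),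
      Real.sqrt_mul (by positivity), Real.sqrt_div zero_le_one, Real.sqrt_one]
    gcongr
    exact (Real.sqrt_le_left (by norm_num)).2 (by norm_num)
  set K := 1 / (1 - γ) with hK
  have hK1 : 1 ≤ K := (one_le_div hγ).2 (by linarith)
  have e1 : rmax / (1 - γ) = rmax * K := by rw [hK]; ring
  have e2 : rmax / (1 - γ) ^ 2 + 2 * LA * d / (1 - γ) = (rmax + 2 * c * d) * K ^ 2 := by
    rw [hc, hK]; field_simp
  have e3 : 1 / (1 - γ) ^ 2 = K ^ 2 := by rw [hK, one_div_pow]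
  have e4 : K * (E + 2 * LA * W) = K ^ 2 * (ξ + 2 * c * W) := by
    rw [hc, hξ, hK]; field_simp
  rw [e1, e2, e3, e4]
  have hq0 : 0 ≤ q := by linarith
  have hKK : K ≤ K ^ 2 := le_self_pow₀ hK1 two_ne_zero
  have hε2 : γ ^ n ≤ 2 * q * ε :=
    hn.trans (le_mul_of_one_le_left hε.le (by linarith))
  have b1 : rmax * K * √(1 / (2 * N) * l) ≤ rmax * K ^ 2 * (u * q) :=
    mul_le_mul (mul_le_mul_of_nonneg_left hKK hr) h1 (Real.sqrt_nonneg _) (by positivity)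
  have b2 : (rmax + 2 * c * d) * K ^ 2 * (√(2 / N * l) + γ ^ n) ≤
      (rmax + 2 * c * d) * K ^ 2 * (2 * (u * q) + 2 * q * ε) :=
    mul_le_mul_of_nonneg_left (add_le_add h2 hε2) (by positivity)
  have b3 : K ^ 2 * (ξ + 2 * c * W) ≤ K ^ 2 * (2 * q * (ξ + 2 * c * W)) :=
    mul_le_mul_of_nonneg_left (le_mul_of_one_le_left (by positivity) (by linarith))
      (by positivity)
  have b4 : 0 ≤ K ^ 2 * q * (rmax * u + 2 * rmax * ε + 2 * ξ) := by positivity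
  linarith

/-- The truncation level `i ≤ L - log ε / log γ` makes the tail weight `γ ^ (L - i)` at most
`ε`. -/
theorem pow_sub_le_of_le_sub_log_div {γ ε : ℝ} (hγ0 : 0 < γ) (hγ1 : γ < 1) (hε : 0 < ε) {i L : ℕ}
    (hiL : i ≤ L) (h : (i : ℝ) ≤ L - Real.log ε / Real.log γ) : γ ^ (L - i) ≤ ε := by
  have hlog : Real.log γ < 0 := Real.log_neg hγ0 hγ1
  rw [← Real.log_le_log_iff (pow_pos hγ0 _) hε, Real.log_pow, Nat.cast_sub hiL]
  exact (div_le_iff_of_neg hlog).1 (by linarith)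

end Asymptotic

/-! ### The error bound with high probability -/

section HighProbability

variable {S A : Type*} [MeasurableSpace S] [MetricSpace A] [SecondCountableTopology A]
  [MeasurableSpace A] [BorelSpace A]

/-- The discrepancy between two policies seen by `|g|`, truncated at `c`. It is measurable in the
state, which is not clear for the Wasserstein distance that dominates it. -/
noncomputable def policyGap (π π' : S → Measure A) (g : S × A → ℝ) (c : ℝ) (s : S) : ℝ :=
  (min (∫⁻ a, ‖g (s, a)‖ₑ ∂(π s) - ∫⁻ a, ‖g (s, a)‖ₑ ∂(π' s)) (ENNReal.ofReal c)).toReal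

omit [MeasurableSpace S] [MetricSpace A] [SecondCountableTopology A] [BorelSpace A] in
theorem policyGap_mem_Icc {π π' : S → Measure A} {g : S × A → ℝ} {c : ℝ} (hc : 0 ≤ c) (s : S) :
    policyGap π π' g c s ∈ Set.Icc 0 c :=
  ⟨ENNReal.toReal_nonneg, ENNReal.toReal_le_of_le_ofReal hc (min_le_right _ _)⟩

theorem lintegral_enorm_le_add_policyGap {π π' : S → Measure A} {g : S × A → ℝ}
    (hg : Measurable g) {K : ℝ≥0} {s : S} (hK : LipschitzWith K fun a => g (s, a))
    [IsProbabilityMeasure (π s)] [IsProbabilityMeasure (π' s)]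
    (hA : Bornology.IsBounded (Set.univ : Set A)) :
    ∫⁻ a, ‖g (s, a)‖ₑ ∂(π s) ≤ ∫⁻ a, ‖g (s, a)‖ₑ ∂(π' s) +
      ENNReal.ofReal (policyGap π π' g (K * Metric.diam (Set.univ : Set A)) s) := by
  have h := (lintegral_enorm_sub_le_wasserstein (g := fun a => g (s, a))
    (hg.comp measurable_prodMk_left) hK (π s) (π' s)).trans (mul_le_mul_right (wasserstein_le_diam hA _ _) _)
  rw [← ENNReal.ofReal_coe_nnreal, ← ENNReal.ofReal_mul K.coe_nonneg] at h
  rw [policyGap, min_eq_left h, ENNReal.ofReal_toReal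
    (ne_top_of_le_ne_top ENNReal.ofReal_ne_top h)]
  exact le_add_tsub

theorem policyGap_le_wasserstein {π π' : S → Measure A} {g : S × A → ℝ}
    (hg : Measurable g) {K : ℝ≥0} {s : S} (hK : LipschitzWith K fun a => g (s, a))
    [IsProbabilityMeasure (π s)] [IsProbabilityMeasure (π' s)]
    (hA : Bornology.IsBounded (Set.univ : Set A)) (c : ℝ) :
    policyGap π π' g c s ≤ K * (wasserstein (π s) (π' s)).toReal := by
  have hfin : wasserstein (π s) (π' s) ≠ ∞ :=
    ne_top_of_le_ne_top ENNReal.ofReal_ne_top (wasserstein_le_diam hA _ _)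
  rw [← ENNReal.coe_toReal, ← ENNReal.toReal_mul]
  exact ENNReal.toReal_mono (ENNReal.mul_ne_top ENNReal.coe_ne_top hfin)
    ((min_le_left _ _).trans
      (lintegral_enorm_sub_le_wasserstein (g := fun a => g (s, a))
        (hg.comp measurable_prodMk_left) hK _ _))

/-- The error bound, multiplied by `1 - γ`, holds with high probability: `Q` is any candidate for
the Q function of a policy `πN`, which need not be one of the episodes' policies. -/
theorem measure_evaluationError_gt_lt {Ω : Type*} [MeasurableSpace Ω] {P : Measure Ω}
    [IsProbabilityMeasure P] (T : Kernel (S × A) S) [IsMarkovKernel T] (ρ₀ : Measure S)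
    [IsProbabilityMeasure ρ₀] {r : S → A → ℝ} (hr : Measurable (Function.uncurry r)) {B : ℝ}
    (hB : ∀ s a, |r s a| ≤ B) {γ : ℝ} (hγ0 : 0 < γ) (hγ1 : γ < 1) {N : ℕ} (hN : 0 < N)
    (π : Fin N → Kernel S A) [∀ e, IsMarkovKernel (π e)] (πN : Kernel S A) [IsMarkovKernel πN]
    {L : ℕ} {X : Fin N → Ω → Fin L → S × A}
    (hX : ∀ e, HasLaw (X e) (episodeLaw T ρ₀ (π e) L) P) (hind : iIndepFun X P)
    {Q : S → A → ℝ} (hQ : Measurable (Function.uncurry Q)) {K : ℝ≥0}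
    (hQK : ∀ s, LipschitzWith K (Q s)) (hqK : ∀ s, LipschitzWith K (qFunction T r γ πN s)) {V : ℝ}
    (hQV : ∀ s a, Q s a ∈ Set.Icc 0 V) (hqV : ∀ s a, qFunction T r γ πN s a ∈ Set.Icc 0 V)
    (hA : Bornology.IsBounded (Set.univ : Set A)) (i : ℕ) {δ : ℝ} (hδ0 : 0 < δ) (hδ1 : δ < 1) :
    P {ω | ¬ (1 - γ) * evaluationError (avgStateDist T ρ₀ π i) (behaviorPolicy T ρ₀ γ π i)
          Q (qFunction T r γ πN) ≤
        (V + 2 * K * Metric.diam (Set.univ : Set A)) *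
          (√(2 / N * Real.log (2 / δ)) + γ ^ (L - i)) +
        (bellmanError T r γ πN Q i (fun e => X e ω) +
          2 * K * mismatchError γ πN (behaviorPolicy T ρ₀ γ π i) i (fun e => X e ω))}
      < ENNReal.ofReal δ := by
  obtain ⟨s₀⟩ : Nonempty S := nonempty_of_isProbabilityMeasure ρ₀
  obtain ⟨a₀⟩ : Nonempty A := nonempty_of_isProbabilityMeasure (πN s₀)
  have hV0 : 0 ≤ V := (hQV s₀ a₀).1.trans (hQV s₀ a₀).2
  set d := Metric.diam (Set.univ : Set A) with hd
  have hd0 : 0 ≤ d := Metric.diam_nonneg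
  set Δ : ℝ := ((K + K : ℝ≥0) : ℝ) * d with hΔ
  have hΔ2 : Δ = 2 * K * d := by rw [hΔ]; push_cast; ring
  have hΔ0 : 0 ≤ Δ := by positivity
  set g : S × A → ℝ := fun z => Q z.1 z.2 - qFunction T r γ πN z.1 z.2 with hg
  set b : S × A → ℝ := fun z => Q z.1 z.2 - bellman T r γ πN Q z.1 z.2 with hb
  have hgm : Measurable g := hQ.sub (measurable_qFunction T πN hr hB hγ0 hγ1)
  have hbm : Measurable b := hQ.sub (measurable_bellman T πN hr hQ)
  have hgb : ∀ z, g z = b z + γ * ∫ y, g y ∂(transition T πN z) :=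
    sub_qFunction_eq T πN hr hB hγ0 hγ1 hQ hQV hqV
  have hgV : ∀ z, |g z| ≤ V := fun z => by
    have h1 := hQV z.1 z.2
    have h2 := hqV z.1 z.2
    exact abs_le.2 ⟨by linarith [h1.1, h2.2], by linarith [h1.2, h2.1]⟩
  have hbV : ∀ z, |b z| ≤ 2 * V := fun z => by
    have h1 : b z = g z - γ * ∫ y, g y ∂(transition T πN z) := by linarith [hgb z]
    have h2 : |γ * ∫ y, g y ∂(transition T πN z)| ≤ V := by
      rw [abs_mul, abs_of_pos hγ0]
      exact (mul_le_of_le_one_left (abs_nonneg _) hγ1.le).trans (abs_integral_le_of_abs_le hgV _)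
    rw [h1]
    exact (abs_sub _ _).trans (by linarith [hgV z])
  have hgK : ∀ s, LipschitzWith (K + K) fun a => g (s, a) := fun s => (hQK s).sub (hqK s)
  set πD := behaviorPolicy T ρ₀ γ π i with hπD
  set D : S → ℝ := policyGap πN πD g Δ with hD
  have hDm : Measurable D :=
    (((Measurable.lintegral_kernel_prod_right' (κ := πN) hgm.enorm).sub
      (measurable_lintegral_behaviorPolicy T ρ₀ π hgm.enorm i)).min measurable_const).ennreal_toReal
  have hDmem : ∀ s, D s ∈ Set.Icc 0 Δ := policyGap_mem_Icc hΔ0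
  have hprob := isProbabilityMeasure_behaviorPolicy T ρ₀ π hγ0 hγ1 i
  have hgap : ∀ᵐ s ∂(∑ e, occupancy T ρ₀ γ (π e) i), ∫⁻ a, ‖g (s, a)‖ₑ ∂(πN s) ≤
      ∫⁻ a, ‖g (s, a)‖ₑ ∂(πD s) + ENNReal.ofReal (D s) := by
    filter_upwards [hprob] with s hs
    exact lintegral_enorm_le_add_policyGap hgm (hgK s) hA
  have hDW : ∀ᵐ s ∂(∑ e, occupancy T ρ₀ γ (π e) i),
      D s ≤ 2 * K * (wasserstein (πN s) (πD s)).toReal := by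
    filter_upwards [hprob] with s hs
    refine (policyGap_le_wasserstein hgm (hgK s) hA Δ).trans (le_of_eq ?_)
    push_cast
    ring
  have hdet := integral_behaviorPolicy_le T ρ₀ π πN hγ0 hγ1 hN hgm hbm hgb hgV hbV hDm
    (fun s => (hDmem s).1) (fun s => (hDmem s).2) hgap (L - i)
  have hconc := measure_bufferAvg_add_lt T ρ₀ hγ0 hγ1 hN π hX hind
    (φ := fun z => |b z| + D z.1) (by fun_prop) (M := 2 * (V + Δ)) (by positivity)
    (fun z => ⟨add_nonneg (abs_nonneg _) (hDmem _).1, by linarith [hbV z, (hDmem z.1).2]⟩)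
    i hδ0 hδ1
  refine (measure_mono_ae ?_).trans_lt hconc
  filter_upwards [ae_forall_buffer T ρ₀ hγ0 hγ1 π hX hDW] with ω hω
  refine fun (hbad : ¬ _) => lt_of_not_ge fun hle => hbad ?_
  have hbuf : bufferAvg γ i (fun e => X e ω) (fun s a => |b (s, a)| + D s) ≤
      bellmanError T r γ πN Q i (fun e => X e ω) +
        2 * K * mismatchError γ πN πD i (fun e => X e ω) := by
    rw [bellmanError, mismatchError, ← bufferAvg_add_const_mul]
    exact bufferAvg_mono hγ0 hγ1 fun e j hij => by
      have := hω e j hij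
      simp only [hb]
      linarith
  have hsqrt : 2 * (V + Δ) * √(Real.log (2 / δ) / (2 * N)) =
      (V + Δ) * √(2 / N * Real.log (2 / δ)) := by
    have h4 : √(2 / N * Real.log (2 / δ)) = 2 * √(Real.log (2 / δ) / (2 * N)) := by
      rw [show 2 / N * Real.log (2 / δ) = 2 ^ 2 * (Real.log (2 / δ) / (2 * N)) by
        have : (N : ℝ) ≠ 0 := by exact_mod_cast hN.ne'
        field_simp, Real.sqrt_mul (by norm_num), Real.sqrt_sq (by norm_num)]
    rw [h4]
    ring
  rw [hsqrt] at hle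
  rw [← hΔ2, mul_add]
  change (1 - γ) * ∫ s, ∫ a, |g (s, a)| ∂(πD s) ∂(avgStateDist T ρ₀ π i) ≤ _
  linarith

end HighProbability

end OffPolicy

theorem corollary1 :
    -- `C` is the absolute constant of the second conclusion
    ∃ C : ℝ, 0 < C ∧
    ∀ (S A Ω : Type*) [MeasurableSpace S]
      [MetricSpace A] [SecondCountableTopology A] [MeasurableSpace A] [BorelSpace A]
      [MeasurableSpace Ω] (P : Measure Ω) [IsProbabilityMeasure P]
      -- the Markov decision process and the initial distribution
      (T : Kernel (S × A) S) [IsMarkovKernel T] (ρ₀ : Measure S) [IsProbabilityMeasure ρ₀]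
      (r : S → A → ℝ) (_ : Measurable (Function.uncurry r)) (_ : ∃ B : ℝ, ∀ s a, |r s a| ≤ B)
      (γ : ℝ) (_ : 0 < γ) (_ : γ < 1)
      -- the policies of the `N` episodes; `πN` is the last one
      (N : ℕ) (hN : 0 < N) (π : Fin N → Kernel S A) [∀ e, IsMarkovKernel (π e)]
      (πN : Kernel S A) [IsMarkovKernel πN] (_ : πN = π ⟨N - 1, Nat.sub_lt hN one_pos⟩)
      -- the sampled trajectories of length `L`, one for each episode
      (L : ℕ) (X : Fin N → Ω → Fin L → S × A)
      (_ : ∀ e, HasLaw (X e) (episodeLaw T ρ₀ (π e) L) P) (_ : iIndepFun X P)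
      -- the learned Q function
      (Qhat : S → A → ℝ) (_ : Measurable (Function.uncurry Qhat))
      -- both Q functions are Lipschitz in the action
      (LA : ℝ≥0) (_ : ∀ s, LipschitzWith LA (Qhat s))
      (_ : ∀ s, LipschitzWith LA (qFunction T r γ πN s))
      -- both Q functions take values in `[0, rmax / (1 - γ)]`
      (rmax : ℝ) (_ : ∀ s a, Qhat s a ∈ Set.Icc 0 (rmax / (1 - γ)))
      (_ : ∀ s a, qFunction T r γ πN s a ∈ Set.Icc 0 (rmax / (1 - γ)))
      -- the action space is bounded
      (_ : Bornology.IsBounded (Set.univ : Set A))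
      -- trajectory step and failure probability
      (i : ℕ) (_ : i ≤ L) (δ : ℝ) (_ : 0 < δ) (_ : δ < 1),
      -- first conclusion
      P {ω | ¬ evaluationError (avgStateDist T ρ₀ π i) (behaviorPolicy T ρ₀ γ π i)
              Qhat (qFunction T r γ πN) ≤
            rmax / (1 - γ) * √(1 / (2 * N) * Real.log (2 / δ))
            + (rmax / (1 - γ) ^ 2 + 2 * LA * Metric.diam (Set.univ : Set A) / (1 - γ))
              * (√(2 / N * Real.log (2 / δ)) + γ ^ (L - i))
            + 1 / (1 - γ) *
              (bellmanError T r γ πN Qhat i (fun e => X e ω)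
                + 2 * LA * mismatchError γ πN (behaviorPolicy T ρ₀ γ π i) i (fun e => X e ω))}
        < ENNReal.ofReal δ
      ∧
      -- second conclusion
      ∀ (ε c : ℝ) (ξ : Ω → ℝ), 0 < ε → ε < 1 →
        (i : ℝ) ≤ L - Real.log ε / Real.log γ →
        (LA : ℝ) = c / (1 - γ) →
        (∀ ω, bellmanError T r γ πN Qhat i (fun e => X e ω) = ξ ω / (1 - γ)) →
        P {ω | ¬ evaluationError (avgStateDist T ρ₀ π i) (behaviorPolicy T ρ₀ γ π i)
                Qhat (qFunction T r γ πN) ≤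
              C * √(Real.log (2 / δ)) * (1 / (1 - γ) ^ 2 *
                ((rmax + c * Metric.diam (Set.univ : Set A)) * (1 / √N + ε)
                  + ξ ω
                  + c * mismatchError γ πN (behaviorPolicy T ρ₀ γ π i) i (fun e => X e ω)))}
          < ENNReal.ofReal δ := by
  refine ⟨4, by norm_num, ?_⟩
  intro S A Ω _ _ _ _ _ _ P _ T _ ρ₀ _ r hr hrB γ hγ0 hγ1 N hN π _ πN _ hπN L X hX hind Qhat hQ LA
    hQL hqL rmax hQV hqV hA i hiL δ hδ0 hδ1
  obtain ⟨B, hB⟩ := hrB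
  have hγ : 0 < 1 - γ := by linarith
  obtain ⟨s₀⟩ : Nonempty S := nonempty_of_isProbabilityMeasure ρ₀
  obtain ⟨a₀⟩ : Nonempty A := nonempty_of_isProbabilityMeasure (πN s₀)
  have hV0 : 0 ≤ rmax / (1 - γ) := (hQV s₀ a₀).1.trans (hQV s₀ a₀).2
  have hr0 : 0 ≤ rmax := by simpa [hγ.ne'] using mul_nonneg hV0 hγ.le
  have h1 : P {ω | ¬ evaluationError (avgStateDist T ρ₀ π i) (behaviorPolicy T ρ₀ γ π i)
              Qhat (qFunction T r γ πN) ≤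
            rmax / (1 - γ) * √(1 / (2 * N) * Real.log (2 / δ))
            + (rmax / (1 - γ) ^ 2 + 2 * LA * Metric.diam (Set.univ : Set A) / (1 - γ))
              * (√(2 / N * Real.log (2 / δ)) + γ ^ (L - i))
            + 1 / (1 - γ) *
              (bellmanError T r γ πN Qhat i (fun e => X e ω)
                + 2 * LA * mismatchError γ πN (behaviorPolicy T ρ₀ γ π i) i (fun e => X e ω))}
        < ENNReal.ofReal δ := by
    refine (measure_mono ?_).trans_lt (measure_evaluationError_gt_lt T ρ₀ hr hB hγ0 hγ1 hN π πN hX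
      hind hQ hQL hqL hQV hqV hA i hδ0 hδ1)
    refine fun ω (hω : ¬ _) (hle : _ ≤ _) => hω ?_
    rw [← le_div_iff₀' hγ] at hle
    -- the first summand of the bound is not needed: the concentration term already covers it
    refine (hle.trans (le_of_eq ?_)).trans (add_le_add_left
      (le_add_of_nonneg_left (mul_nonneg hV0 (Real.sqrt_nonneg _))) _)
    field_simp
  refine ⟨h1, fun ε c ξ hε0 _ hi hLA hξ => (measure_mono ?_).trans_lt h1⟩
  refine fun ω (hω : ¬ _) (hle : _ ≤ _) => hω (hle.trans ?_)
  exact bound_le_rate hN hγ1 hr0 LA.coe_nonneg Metric.diam_nonneg hε0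
    (Real.log_le_log (by norm_num) ((le_div_iff₀ hδ0).2 (by linarith)))
    (bufferAvg_nonneg hγ0 hγ1 _ _ fun _ _ => ENNReal.toReal_nonneg)
    (bufferAvg_nonneg hγ0 hγ1 _ _ fun _ _ => abs_nonneg _)
    (pow_sub_le_of_le_sub_log_div hγ0 hγ1 hε0 hiL hi) hγ0 hLA (hξ ω)
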